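/- **Setting.** Let $G$ be a finite group with identity $e$. Let $\Sigma$ be a closed planar lattice: a finite connected directed graph, with set of arrows $E$, cellularly embedded in the oriented sphere (a plane without boundary; combinatorially, a connected rotation system with $|V|-|E|+|P|=2$, where $V$ is the set of vertices and $P$ the set of faces). Let $\mathcal H=\bigotimes_{E}\mathbb CG$, with orthonormal basis the assignments $E\to G$. A site $s=(v,p)$ is a corner of the face $p$ at the vertex $v$. At a site, $h\in G$ acts by $h\triangleright$: $g\mapsto hg$ on arrows leaving $v$ and $g\mapsto gh^{-1}$ on arrows entering $v$; and $\delta_f\triangleright$ projects onto the states for which the product of the group elements clockwise around $p$ from $v$ is $f$ (arrows met against their direction enter inversely). Put $A(v)=|G|^{-1}\sum_{h}h\triangleright$ and $B(p)=\delta_e\triangleright$. A ribbon $\xi$ from $s_0=(v_0,p_0)$ to $s_1=(v_1,p_1)$ is a sequence of sites from $s_0$ to $s_1$ in which each step is either a direct triangle $\tau$ (keep $p$, move $v$ along one edge clockwise around $p$) or a dual triangle $\tau^*$ (keep $v$, rotate anticlockwise around $v$ across one edge into the next face). The operator of a direct triangle is $F^{h,g}_\tau=T^g_\tau$, the projection onto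 the states whose walked edge carries $g$; that of a dual triangle is $F^{h,g}_{\tau^*}=\delta_{g,e}L^h_{\tau^*}$, where $L^h_{\tau^*}$ acts on the crossed edge as $h\triangleright$ does at the end at $v$. The operator of a ribbon is given by $$F^{h,g}_{\xi'\circ\xi}=\sum_{f\in G}F^{f^{-1}hf,\,f^{-1}g}_{\xi'}\circ F^{h,f}_{\xi},$$ with $F^{h,g}=\delta_{g,e}\,\mathrm{id}$ for the ribbon of length $0$. The quantum double $D(G)=\mathbb C(G)\rtimes\mathbb CG$ has basis $\delta_h g$ $(h,g\in G)$, relations $g\,\delta_h=\delta_{ghg^{-1}}\,g$, and antipode $S(\delta_h g)=\delta_{g^{-1}h^{-1}g}\,g^{-1}$. Sites $s_0,s_1$ are disjoint if $v_0\ne v_1$ and $p_0\ne p_1$. A ribbon is non-self-crossing if no arrow is both walked and crossed by it. Two ribbons from $s_0$ to $s_1$ are homotopic if the edge paths from $v_0$ to $v_1$ that they walk are homotopic with fixed end points in $\Sigma$ with the faces $p_0,p_1$ removed. **Proposition.** Let $|\mathrm{vac}\rangle\in\mathcal H$ be a vacuum vector, i.e. a nonzero vector with $A(v)|\mathrm{vac}\rangle=B(p)|\mathrm{vac}\rangle=|\mathrm{vac}\rangle$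 for all $v,p$. Let $s_0=(v_0,p_0)$, $s_1=(v_1,p_1)$ be sites and, for a ribbon $\xi$ from $s_0$ to $s_1$, let $|\psi^{h,g}_\xi\rangle=F^{h,g}_\xi|\mathrm{vac}\rangle$. 1. If $\xi,\xi'$ are non-self-crossing ribbons from $s_0$ to $s_1$, and they are homotopic or $s_0,s_1$ are not disjoint, then $|\psi^{h,g}_{\xi}\rangle=|\psi^{h,g}_{\xi'}\rangle$ for all $h,g\in G$. For arbitrary ribbons $\xi,\xi'$ from $s_0$ to $s_1$ there is $n\in\mathbb Z$ such that $|\psi^{h,g}_{\xi'}\rangle=|\psi^{h,\,h^ng}_{\xi}\rangle$ for all $h,g\in G$. 2. For every ribbon $\xi$ from $s_0$ to $s_1$, the vectors $|\psi^{h,g}_\xi\rangle$, $h,g\in G$, span $$\mathcal L(s_0,s_1)=\{|\psi\rangle\in\mathcal H : A(v)|\psi\rangle=B(p)|\psi\rangle=|\psi\rangle\ \ \forall v\notin\{v_0,v_1\},\ p\notin\{p_0,p_1\}\}.$$ 3. If $s_0,s_1$ are disjoint, then for every ribbon $\xi$ from $s_0$ to $s_1$ the family $(|\psi^{h,g}_\xi\rangle)_{h,g\in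 G}$ is an orthogonal basis of $\mathcal L(s_0,s_1)$. 4. If $s_0,s_1$ are disjoint, then $\mathcal L(s_0,s_1)$ is invariant under the actions of $D(G)$ at $s_0$ and at $s_1$, and for every ribbon $\xi$ from $s_0$ to $s_1$ and all $f,h,g\in G$ $$f\triangleright_{s_0}|\psi^{h,g}_\xi\rangle=|\psi^{fhf^{-1},fg}_\xi\rangle,\qquad \delta_f\triangleright_{s_0}|\psi^{h,g}_\xi\rangle=\delta_{f,h}|\psi^{h,g}_\xi\rangle,$$ $$f\triangleright_{s_1}|\psi^{h,g}_\xi\rangle=|\psi^{h,gf^{-1}}_\xi\rangle,\qquad \delta_f\triangleright_{s_1}|\psi^{h,g}_\xi\rangle=\delta_{f,\,g^{-1}h^{-1}g}|\psi^{h,g}_\xi\rangle.$$ Moreover $|\psi^{h,g}_\xi\rangle\mapsto\delta_hg$ defines a linear isomorphism $\mathcal L(s_0,s_1)\cong D(G)$ that carries the action of $a\in D(G)$ at $s_0$ to the left regular representation $x\mapsto ax$, and the action of $a$ at $s_1$ to the right regular representation, made into a left action by the antipode, $x\mapsto x\,S(a)$. -/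

import Mathlib

open scoped InnerProductSpace

set_option linter.unusedSectionVars false

namespace Kitaev

/-! ### The lattice

A lattice on a closed oriented surface with set of arrows `E` is encoded as a ribbon graph (rotation
system).  A dart is an arrow together with one of its two ends, `(e, true)` being the tail of `e`
and `(e, false)` its head; we read a dart as the edge leaving that end. -/

/-- The darts (half-edges) of a lattice with set of arrows `E`. -/
abbrev Dart (E : Type*) := E × Bool

/-- The same edge seen from its other end. -/
def flip {E : Type*} : Equiv.Perm (Dart E) where
  toFun d := (d.1, !d.2)
  invFun d := (d.1, !d.2)
  left_inv d := by simp
  right_inv d := by simp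

/-- A lattice (ribbon graph): `rot d` is the next dart after `d`, anticlockwise around the vertex
from which `d` leaves. -/
structure Lattice (E : Type*) where
  rot : Equiv.Perm (Dart E)

variable {E : Type*}

/-- A site `(v, p)`, i.e. a vertex `v` on the boundary of a face `p` with its cilium from `v` into
`p`, is a corner of the lattice.  It is encoded by a dart `d`: the corner at the vertex of `d` that
lies between `d` and the next dart `rot d` anticlockwise. -/
abbrev Lattice.Site (_Γ : Lattice E) := Dart E

namespace Lattice

variable (Γ : Lattice E)

/-- From a corner of a face to the next corner of the same face, clockwise around the face.  This
walks along the edge `rot d`, which has the face on its right. -/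
def next : Equiv.Perm (Dart E) := Γ.rot.trans flip

/-- Vertices are the orbits of darts under rotation. -/
abbrev Vertex := Quotient (Equiv.Perm.SameCycle.setoid Γ.rot)

/-- Faces are the orbits of corners under `next`. -/
abbrev Face := Quotient (Equiv.Perm.SameCycle.setoid Γ.next)

/-- The vertex from which a dart leaves; also the vertex of a site. -/
def vertex (d : Dart E) : Γ.Vertex := Quotient.mk _ d

/-- The face of a site. -/
def face (s : Γ.Site) : Γ.Face := Quotient.mk _ s

/-- The surface is connected and has Euler characteristic `|V| - |E| + |F| = 2`: the lattice lies on
a sphere, that is, on a closed plane (a plane without boundary). -/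
def IsPlanar : Prop :=
  MulAction.IsPretransitive (Subgroup.closure {Γ.rot, flip} : Subgroup (Equiv.Perm (Dart E)))
    (Dart E) ∧
  Nat.card Γ.Vertex + Nat.card Γ.Face = Nat.card E + 2

/-- Two sites are disjoint if they share neither the vertex nor the face. -/
def Disjoint (s t : Γ.Site) : Prop :=
  Γ.vertex s ≠ Γ.vertex t ∧ Γ.face s ≠ Γ.face t

/-- The clockwise boundary path of a face, starting and ending at the vertex of the site `s`. -/
noncomputable def boundary (s : Γ.Site) : List (Dart E) :=
  (List.range (Function.minimalPeriod Γ.next s)).map fun i => Γ.rot ((Γ.next)^[i] s)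

/-! ### Ribbons -/

end Lattice

/-- The two kinds of triangles of which ribbons are composed. -/
inductive Triangle
  | direct
  | dual

namespace Lattice

variable (Γ : Lattice E)

/-- The end site of a triangle with start site `s`: the direct triangle keeps the face and walks
clockwise along its boundary, along the edge `rot s`; the dual triangle keeps the vertex, rotates
anticlockwise around it and crosses the edge `rot s`. -/
def step (s : Γ.Site) : Triangle → Γ.Site
  | .direct => flip (Γ.rot s)
  | .dual => Γ.rot s

/-- The end site of a sequence of triangles with start site `s`. -/
def endSite : Γ.Site → List Triangle → Γ.Site
  | s, [] => s
  | s, t :: w => endSite (Γ.step s t) w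

/-- A ribbon from the site `s₀` to the site `s₁`: a composable sequence of triangles. -/
def Ribbon (s₀ s₁ : Γ.Site) := {w : List Triangle // Γ.endSite s₀ w = s₁}

/-- The edges (as darts) along the direct triangles of a sequence of triangles: the path of vertices
on one side of the ribbon. -/
def walked : Γ.Site → List Triangle → List (Dart E)
  | _, [] => []
  | s, .direct :: w => Γ.rot s :: walked (Γ.step s .direct) w
  | s, .dual :: w => walked (Γ.step s .dual) w

/-- The edges (as darts) crossed by the dual triangles of a sequence of triangles. -/
def crossed : Γ.Site → List Triangle → List (Dart E)
  | _, [] => []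
  | s, .direct :: w => crossed (Γ.step s .direct) w
  | s, .dual :: w => Γ.rot s :: crossed (Γ.step s .dual) w

/-- A ribbon does not cross itself if no arrow lies on its direct path and is also crossed by it. -/
def Ribbon.NonSelfCrossing {Γ : Lattice E} {s₀ s₁ : Γ.Site} (ξ : Γ.Ribbon s₀ s₁) : Prop :=
  ∀ d ∈ Γ.walked s₀ ξ.1, ∀ d' ∈ Γ.crossed s₀ ξ.1, d.1 ≠ d'.1

/-- The end vertex of an edge path with start vertex `v`. -/
def pathEnd (v : Γ.Vertex) (u : List (Dart E)) : Γ.Vertex :=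
  u.foldl (fun _ d => Γ.vertex (flip d)) v

/-- Homotopy with fixed end points of edge paths starting at the vertex `v`, in the surface with the
faces in `P` removed: insert or delete an edge followed by its reverse, or the boundary of a face
that is not in `P`. -/
inductive Homotopic (P : Set Γ.Face) (v : Γ.Vertex) : List (Dart E) → List (Dart E) → Prop
  | refl (u : List (Dart E)) : Homotopic P v u u
  | symm {u u' : List (Dart E)} : Homotopic P v u u' → Homotopic P v u' u
  | trans {u u' u'' : List (Dart E)} :
      Homotopic P v u u' → Homotopic P v u' u'' → Homotopic P v u u''
  | spur (u u' : List (Dart E)) (d : Dart E) (hd : Γ.pathEnd v u = Γ.vertex d) :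
      Homotopic P v (u ++ u') (u ++ [d, flip d] ++ u')
  | face (u u' : List (Dart E)) (s : Γ.Site) (hs : Γ.pathEnd v u = Γ.vertex s)
      (hP : Γ.face s ∉ P) :
      Homotopic P v (u ++ u') (u ++ Γ.boundary s ++ u')

/-- Two ribbons with the same end sites are homotopic if their direct paths are homotopic with fixed
end points in the surface punctured at the two end faces. -/
def Ribbon.Homotopic {Γ : Lattice E} {s₀ s₁ : Γ.Site} (ξ ξ' : Γ.Ribbon s₀ s₁) : Prop :=
  Lattice.Homotopic Γ {Γ.face s₀, Γ.face s₁} (Γ.vertex s₀)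
    (Γ.walked s₀ ξ.1) (Γ.walked s₀ ξ'.1)

end Lattice

/-! ### The Hilbert space and the site actions -/

variable {G : Type*} [Group G] [Fintype G] [DecidableEq G] [Fintype E] [DecidableEq E]

/-- The tensor product over all arrows of copies of `ℂ G`, where the elements of `G` are an
orthonormal basis of `ℂ G`: it has the orthonormal basis of all assignments `E → G`. -/
abbrev Hilb (E G : Type*) := EuclideanSpace ℂ (E → G)

/-- The basis vector `|x⟩`. -/
noncomputable def ket (x : E → G) : Hilb E G := EuclideanSpace.single x 1

/-- The linear operator with `|x⟩ ↦ f x`. -/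
noncomputable def opOfKets (f : (E → G) → Hilb E G) : Hilb E G →ₗ[ℂ] Hilb E G :=
  (EuclideanSpace.basisFun (E → G) ℂ).toBasis.constr ℂ f

/-- The group element along a dart: an arrow walked against its direction counts inversely. -/
def along (x : E → G) (d : Dart E) : G := if d.2 then x d.1 else (x d.1)⁻¹

/-- Multiply the group element along the dart `d` by `h` from the left: `x_e ↦ h x_e` if `d` is
the tail of `e`, and `x_e ↦ x_e h⁻¹` if it is the head. -/
def mulDart (h : G) (d : Dart E) (x : E → G) : E → G :=
  Function.update x d.1 (if d.2 then h * x d.1 else x d.1 * h⁻¹)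

namespace Lattice

variable (Γ : Lattice E)

/-- The action of `h ∈ G` at the vertex `v` on assignments: all arrows leaving `v` are multiplied by
`h` from the left and all arrows entering it by `h⁻¹` from the right. -/
noncomputable def gauge (v : Γ.Vertex) (h : G) (x : E → G) : E → G := fun e =>
  open Classical in
  (if Γ.vertex (e, true) = v then h else 1) * x e * (if Γ.vertex (e, false) = v then h⁻¹ else 1)

/-- The operator `h ▷` at the vertex `v`. -/
noncomputable def vertexAct (v : Γ.Vertex) (h : G) : Hilb E G →ₗ[ℂ] Hilb E G :=
  opOfKets fun x => ket (Γ.gauge v h x)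

/-- The product of the group elements clockwise around the face of the site `s`, starting at the
vertex of `s`. -/
noncomputable def holonomy (s : Γ.Site) (x : E → G) : G :=
  ((Γ.boundary s).map (along x)).prod

/-- The operator `δ_g ▷` at the site `s`. -/
noncomputable def faceAct (s : Γ.Site) (g : G) : Hilb E G →ₗ[ℂ] Hilb E G :=
  opOfKets fun x => if Γ.holonomy s x = g then ket x else 0

/-- `A(v)`. -/
noncomputable def A (v : Γ.Vertex) : Hilb E G →ₗ[ℂ] Hilb E G :=
  ((Fintype.card G : ℂ)⁻¹) • ∑ h : G, Γ.vertexAct v h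

/-- `B(p)`, where `p` is the face of the site `s`.  It does not depend on the vertex of `s`, as
`δ_e` of a product is invariant under cyclic rotations. -/
noncomputable def B (s : Γ.Site) : Hilb E G →ₗ[ℂ] Hilb E G := Γ.faceAct s 1

/-- The space of vacuum states. -/
def vacuum : Submodule ℂ (Hilb E G) where
  carrier := {ψ | (∀ v, Γ.A v ψ = ψ) ∧ ∀ s, Γ.B s ψ = ψ}
  add_mem' ha hb := ⟨fun v => by rw [map_add, ha.1, hb.1], fun s => by rw [map_add, ha.2, hb.2]⟩
  zero_mem' := ⟨fun _ => map_zero _, fun _ => map_zero _⟩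
  smul_mem' c _ ha := ⟨fun v => by rw [map_smul, ha.1], fun s => by rw [map_smul, ha.2]⟩

/-- The space `L(s₀, s₁)` of states that are vacuum away from the sites `s₀` and `s₁`. -/
def stateSpace (s₀ s₁ : Γ.Site) : Submodule ℂ (Hilb E G) where
  carrier := {ψ | (∀ v, v ≠ Γ.vertex s₀ → v ≠ Γ.vertex s₁ → Γ.A v ψ = ψ) ∧
    ∀ s, Γ.face s ≠ Γ.face s₀ → Γ.face s ≠ Γ.face s₁ → Γ.B s ψ = ψ}
  add_mem' ha hb := ⟨fun v h h' => by rw [map_add, ha.1 v h h', hb.1 v h h'],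
    fun s h h' => by rw [map_add, ha.2 s h h', hb.2 s h h']⟩
  zero_mem' := ⟨fun _ _ _ => map_zero _, fun _ _ _ => map_zero _⟩
  smul_mem' c _ ha := ⟨fun v h h' => by rw [map_smul, ha.1 v h h'],
    fun s h h' => by rw [map_smul, ha.2 s h h']⟩

/-! ### Ribbon operators -/

/-- The operators `F_τ^{h,g} = T_τ^g` of the direct and `F_{τ*}^{h,g} = δ_{g,e} L_{τ*}^h` of the dual
triangle with start site `s`. -/
noncomputable def triangleOp (s : Γ.Site) : Triangle → G → G → (Hilb E G →ₗ[ℂ] Hilb E G)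
  | .direct, _, g => opOfKets fun x => if along x (Γ.rot s) = g then ket x else 0
  | .dual, h, g => if g = 1 then opOfKets fun x => ket (mulDart h (Γ.rot s) x) else 0

/-- The operator of a sequence of triangles with start site `s`, by the composition rule
`F_{ξ'∘ξ}^{h,g} = ∑_f F_{ξ'}^{f⁻¹hf, f⁻¹g} ∘ F_ξ^{h,f}`; the empty sequence has
`F^{h,g} = δ_{g,e} id`. -/
noncomputable def ribbonOpAux : Γ.Site → List Triangle → G → G → (Hilb E G →ₗ[ℂ] Hilb E G)
  | _, [], _, g => if g = 1 then LinearMap.id else 0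
  | s, t :: w, h, g =>
      ∑ f : G, ribbonOpAux (Γ.step s t) w (f⁻¹ * h * f) (f⁻¹ * g) ∘ₗ Γ.triangleOp s t h f

end Lattice

/-- The ribbon operator `F_ξ^{h,g}`. -/
noncomputable def Lattice.Ribbon.op {Γ : Lattice E} {s₀ s₁ : Γ.Site} (ξ : Γ.Ribbon s₀ s₁)
    (h g : G) : Hilb E G →ₗ[ℂ] Hilb E G :=
  Γ.ribbonOpAux s₀ ξ.1 h g

/-! ### The quantum double `D(G)` -/

/-- `D(G) = ℂ(G) ⋊ ℂ G`; the value of `a` at `(g, h)` is the coefficient of `δ_g ⊗ h`. -/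
def QDouble (G : Type*) := G × G → ℂ

namespace QDouble

noncomputable instance : AddCommGroup (QDouble G) := inferInstanceAs (AddCommGroup (G × G → ℂ))
noncomputable instance : Module ℂ (QDouble G) := inferInstanceAs (Module ℂ (G × G → ℂ))

/-- The basis element `δ_g ⊗ h`. -/
def delta (g h : G) : QDouble G := fun i => if i = (g, h) then 1 else 0

/-- `(δ_g ⊗ h)(δ_f ⊗ k) = δ_{g, hfh⁻¹} δ_g ⊗ hk`, extended bilinearly. -/
instance : Mul (QDouble G) where
  mul a b := fun i => ∑ k : G, a (i.1, k) * b (k⁻¹ * i.1 * k, k⁻¹ * i.2)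

instance : One (QDouble G) where
  one := fun i => if i.2 = 1 then 1 else 0

theorem mul_apply (a b : QDouble G) (g h : G) :
    (a * b) (g, h) = ∑ k : G, a (g, k) * b (k⁻¹ * g * k, k⁻¹ * h) := rfl

theorem one_apply (g h : G) : (1 : QDouble G) (g, h) = if h = 1 then 1 else 0 := rfl

theorem add_apply (a b : QDouble G) (i : G × G) : (a + b) i = a i + b i := rfl

theorem zero_apply (i : G × G) : (0 : QDouble G) i = 0 := rfl

theorem smul_apply (c : ℂ) (a : QDouble G) (i : G × G) : (c • a) i = c * a i := rfl

noncomputable instance : Ring (QDouble G) :=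
  { (inferInstance : AddCommGroup (QDouble G)), (inferInstance : Mul (QDouble G)),
    (inferInstance : One (QDouble G)) with
    left_distrib := fun a b c => by
      funext ⟨g, h⟩
      simp only [mul_apply, add_apply, mul_add, Finset.sum_add_distrib]
    right_distrib := fun a b c => by
      funext ⟨g, h⟩
      simp only [mul_apply, add_apply, add_mul, Finset.sum_add_distrib]
    zero_mul := fun a => by
      funext ⟨g, h⟩
      simp [mul_apply, zero_apply]
    mul_zero := fun a => by
      funext ⟨g, h⟩
      simp [mul_apply, zero_apply]
    mul_assoc := fun a b c => by
      funext ⟨g, h⟩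
      simp only [mul_apply, Finset.sum_mul, Finset.mul_sum]
      rw [Finset.sum_comm]
      refine Finset.sum_congr rfl fun l _ => ?_
      refine (Equiv.sum_comp (Equiv.mulLeft l) _).symm.trans (Finset.sum_congr rfl fun k _ => ?_)
      simp [mul_assoc]
    one_mul := fun a => by
      funext ⟨g, h⟩
      simp [mul_apply, one_apply]
    mul_one := fun a => by
      funext ⟨g, h⟩
      rw [mul_apply, Finset.sum_eq_single h]
      · simp [one_apply]
      · intro k _ hk
        rw [one_apply, if_neg, mul_zero]
        intro hh
        exact hk (inv_mul_eq_one.mp hh)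
      · simp }

noncomputable instance : Algebra ℂ (QDouble G) :=
  Algebra.ofModule
    (fun c a b => by
      funext ⟨g, h⟩
      simp only [mul_apply, smul_apply, Finset.mul_sum, mul_assoc])
    (fun c a b => by
      funext ⟨g, h⟩
      simp only [mul_apply, smul_apply, Finset.mul_sum]
      exact Finset.sum_congr rfl fun k _ => by ring)

/-- The antipode `S(δ_g ⊗ h) = δ_{h⁻¹g⁻¹h} ⊗ h⁻¹`, extended linearly. -/
def antipode : QDouble G →ₗ[ℂ] QDouble G where
  toFun a := fun i => a (i.2⁻¹ * i.1⁻¹ * i.2, i.2⁻¹)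
  map_add' _ _ := rfl
  map_smul' _ _ := rfl

theorem antipode_delta (g h : G) :
    antipode (delta g h) = delta (h⁻¹ * g⁻¹ * h) h⁻¹ := by
  funext ⟨a, b⟩
  change (if (b⁻¹ * a⁻¹ * b, b⁻¹) = (g, h) then (1 : ℂ) else 0) =
    if (a, b) = (h⁻¹ * g⁻¹ * h, h⁻¹) then 1 else 0
  congr 1
  simp only [Prod.mk.injEq, eq_iff_iff]
  constructor
  · rintro ⟨rfl, rfl⟩
    simp [mul_assoc]
  · rintro ⟨rfl, rfl⟩
    simp [mul_assoc]

theorem delta_mul_delta (g h f k : G) :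
    delta g h * delta f k = if g = h * f * h⁻¹ then delta g (h * k) else 0 := by
  funext ⟨a, b⟩
  rw [mul_apply, Finset.sum_eq_single h]
  · split_ifs with hg
    · subst hg
      simp only [delta, Prod.mk.injEq, and_true, mul_ite, mul_one, mul_zero, ← ite_and]
      congr 1
      simp only [eq_iff_iff]
      constructor
      · rintro ⟨⟨-, h2⟩, h3⟩
        exact ⟨h3, by rw [← h2]; group⟩
      · rintro ⟨rfl, rfl⟩
        simp [mul_assoc]
    · simp only [delta, zero_apply, Prod.mk.injEq, and_true, mul_ite, mul_one, mul_zero, ← ite_and]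
      rw [if_neg]
      rintro ⟨⟨h1, -⟩, h3⟩
      exact hg (by rw [← h1, ← h3]; group)
  · intro l _ hl
    simp [delta, hl]
  · simp

end QDouble

/-- The action of `D(G)` on the Hilbert space at the site `s`, by `(δ_g ⊗ h) ▷ = (δ_g ▷)(h ▷)`. -/
noncomputable def Lattice.siteAct (Γ : Lattice E) (s : Γ.Site) :
    QDouble G →ₗ[ℂ] (Hilb E G →ₗ[ℂ] Hilb E G) where
  toFun a := ∑ g : G, ∑ h : G, a (g, h) • (Γ.faceAct s g ∘ₗ Γ.vertexAct (Γ.vertex s) h)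
  map_add' a b := by
    simp only [QDouble.add_apply, add_smul, Finset.sum_add_distrib]
  map_smul' c a := by
    simp only [QDouble.smul_apply, mul_smul, Finset.smul_sum, RingHom.id_apply]

end Kitaev

namespace Kitaev

/-! ### Spanning trees -/

/-! Read a basis vector as a connection on the lattice: the operators `h ▷` are gauge
transformations, and `δ_f ▷` measures holonomy. A vector of the state space is invariant under gauge
transformations trivial at the two end vertices, and it is supported on connections that are flat
off the two end faces. So everything rests on classifying these connections.

Planarity enters through Euler's formula: a spanning tree and a disjoint spanning tree of the dual
graph together use every edge (`IsPlanar.exists_tree_cotree`). Gauging the tree edges to 1 and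
propagating flatness through the dual tree leaves values in one cyclic group
(`IsPlanar.exists_twist_mem_zpowers`). Over an abelian group, the holonomies off one face determine
a connection up to gauge. Hence, if `a` is an integral connection with flux 1 and -1 at the end
faces, each connection in question is a gauge transform of `h ^ a` for some `h`
(`IsPlanar.exists_eq_twist_zpow`). The sums `orbitState` over gauge orbits therefore span the state
space. At disjoint sites their supports are pairwise disjoint: `h` is the flux at the first site,
and the gauge is determined by its value at one vertex.

A ribbon supplies such an `a`, its `cochain`, by running on the trivial integral connection with
flux 1. Running commutes with gauge transformations and with passing from integers to powers of `h`
(`run_twist_comp`). So a ribbon operator maps the vacuum, which is the sum of all flat connections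
up to a factor, to a multiple of an orbit state whose label `g` is shifted by a power of `h`, the
`winding` (`Ribbon.op_orbitState`). Changing the ribbon changes `a` by an integral gauge
transformation, which shifts the label by a further power of `h`; both shifts vanish in the
situation of the first claim (`IsPlanar.twist_eq_one_of_nonSelfCrossing`). The site actions reindex
the sum over gauges. -/

/-- Breadth-first search: if every point leads to `r` along `R`, then there is a rank function such
that every point other than `r` is related to a point of smaller rank. -/
theorem exists_rank {X : Type*} (R : X → X → Prop) (r : X)
    (h : ∀ x, Relation.ReflTransGen R x r) :
    ∃ rank : X → ℕ, ∀ x, x ≠ r → ∃ y, R x y ∧ rank y < rank x := by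
  classical
  -- `S n` consists of the points with a walk of exactly `n` steps to `r`; the rank is the least
  -- such `n`.
  let S : ℕ → Set X := fun n =>
    Nat.rec (motive := fun _ => Set X) {r} (fun _ T => {x | ∃ y ∈ T, R x y}) n
  have hS : ∀ x : X, ∃ n : ℕ, x ∈ S n := by
    intro x
    induction h x using Relation.ReflTransGen.head_induction_on with
    | refl => exact ⟨0, rfl⟩
    | head hxy _ ih =>
      obtain ⟨n, hn⟩ := ih
      exact ⟨n + 1, _, hn, hxy⟩
  refine ⟨fun x : X => Nat.find (hS x), fun x hx => ?_⟩
  have hfind := Nat.find_spec (hS x)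
  rcases hn : Nat.find (hS x) with _ | n
  · rw [hn] at hfind
    exact absurd hfind hx
  · rw [hn] at hfind
    obtain ⟨y, hy, hxy⟩ := hfind
    exact ⟨y, hxy, by simpa [hn, Nat.lt_succ_iff] using Nat.find_min' (hS y) hy⟩

/-- Recursion along the parents of a spanning tree. -/
theorem exists_of_parent {X α : Type*} (r : X) (rank : X → ℕ) (p : X → X)
    (hp : ∀ x, x ≠ r → rank (p x) < rank x) (a : α) (F : X → α → α) :
    ∃ k : X → α, k r = a ∧ ∀ x, x ≠ r → k x = F x (k (p x)) := by
  classical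
  let k : X → α := (measure rank).wf.fix (C := fun _ => α) fun x ih =>
    if h : x = r then a else F x (ih (p x) (hp x h))
  refine ⟨k, ?_, fun x hx => ?_⟩
  · change (measure rank).wf.fix (C := fun _ => α) _ r = a
    rw [WellFounded.fix_eq, dif_pos rfl]
  · change (measure rank).wf.fix (C := fun _ => α) _ x = _
    rw [WellFounded.fix_eq, dif_neg hx]

section Tree

variable {E X : Type*}

theorem flip_flip (d : Dart E) : flip (flip d) = d := flip.left_inv d

/-- A spanning tree with root `r` of the graph with edges `E` where the dart `d` leaves from `fc d`:
the first edge of the path from `x` to the root is `c x`. -/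
structure IsTree (fc : Dart E → X) (r : X) (rank : X → ℕ) (c : X → Dart E) : Prop where
  source : ∀ x, x ≠ r → fc (c x) = x
  rank_lt : ∀ x, x ≠ r → rank (fc (flip (c x))) < rank x

/-- The predicate `allowed` serves to keep the dual tree away from the edges of the primal tree. -/
theorem exists_isTree (fc : Dart E → X) (r : X) (allowed : Dart E → Prop)
    (hne : Nonempty (Dart E))
    (h : ∀ x, Relation.ReflTransGen
      (fun x y => ∃ d, allowed d ∧ fc d = x ∧ fc (flip d) = y) x r) :
    ∃ rank c, IsTree fc r rank c ∧ ∀ x, x ≠ r → allowed (c x) := by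
  classical
  obtain ⟨rank, hrank⟩ := exists_rank _ r h
  have : ∀ x, ∃ d, x ≠ r → allowed d ∧ fc d = x ∧ rank (fc (flip d)) < rank x := by
    intro x
    by_cases hx : x = r
    · exact ⟨hne.some, fun h => absurd hx h⟩
    · obtain ⟨y, ⟨d, hd, rfl, rfl⟩, hlt⟩ := hrank x hx
      exact ⟨d, fun _ => ⟨hd, rfl, hlt⟩⟩
  choose c hc using this
  exact ⟨rank, c, ⟨fun x hx => (hc x hx).2.1, fun x hx => (hc x hx).2.2⟩, fun x hx => (hc x hx).1⟩

theorem eq_or_eq_flip {d d' : Dart E} (h : d.1 = d'.1) : d = d' ∨ d = flip d' := by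
  obtain ⟨e, b⟩ := d
  obtain ⟨e', b'⟩ := d'
  obtain rfl : e = e' := h
  cases b <;> cases b' <;> simp [flip]

/-- If distinct points shared their parent edge, each would be the parent of the other and so have
the smaller rank. -/
theorem IsTree.edge_injOn {fc : Dart E → X} {r : X} {rank : X → ℕ} {c : X → Dart E}
    (hc : IsTree fc r rank c) : Set.InjOn (fun x => (c x).1) {x | x ≠ r} := by
  intro x hx y hy hxy
  rcases eq_or_eq_flip hxy with h | h
  · rw [← hc.source x hx, h, hc.source y hy]
  · have h1 := hc.rank_lt x hx
    have h2 := hc.rank_lt y hy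
    rw [h, flip_flip, hc.source y hy] at h1
    rw [← h, hc.source x hx] at h2
    omega

theorem IsTree.ncard_edges [Finite X] {fc : Dart E → X} {r : X} {rank : X → ℕ} {c : X → Dart E}
    (hc : IsTree fc r rank c) : ((fun x => (c x).1) '' {x | x ≠ r}).ncard + 1 = Nat.card X := by
  rw [hc.edge_injOn.ncard_image, ← Set.ncard_univ, ← Set.ncard_sdiff_singleton_add_one
    (Set.mem_univ r) Set.finite_univ]
  congr 2
  ext x
  simp

theorem mem_of_list_prod_mem {G α : Type*} [Group G] (K : Subgroup G) (f : α → G)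
    {l : List α} (hl : l.Nodup) {a : α} (ha : a ∈ l) (h : ∀ b ∈ l, b ≠ a → f b ∈ K)
    (hprod : (l.map f).prod ∈ K) : f a ∈ K := by
  obtain ⟨l₁, l₂, rfl⟩ := List.append_of_mem ha
  rw [List.nodup_middle, List.nodup_cons] at hl
  have ha' := hl.1
  rw [List.mem_append, not_or] at ha'
  have h₁ : (l₁.map f).prod ∈ K := K.list_prod_mem fun y hy => by
    obtain ⟨b, hb, rfl⟩ := List.mem_map.mp hy
    exact h b (by simp [hb]) fun hba => ha'.1 (hba ▸ hb)
  have h₂ : (l₂.map f).prod ∈ K := K.list_prod_mem fun y hy => by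
    obtain ⟨b, hb, rfl⟩ := List.mem_map.mp hy
    exact h b (by simp [hb]) fun hba => ha'.2 (hba ▸ hb)
  rw [List.map_append, List.map_cons, List.prod_append, List.prod_cons,
    K.mul_mem_cancel_left h₁, K.mul_mem_cancel_right h₂] at hprod
  exact hprod

/-- Let the values of `f` lie in `K` except on the edges of a spanning tree.  If, for every vertex
other than the root, the product of the values around it lies in `K`, then so do all values. -/
theorem IsTree.mem_of_prod_mem {G : Type*} [Group G] [Finite X] {fc : Dart E → X} {r : X}
    {rank : X → ℕ} {c : X → Dart E} (hc : IsTree fc r rank c) (K : Subgroup G) (f : Dart E → G)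
    (hf : ∀ d, f (flip d) = (f d)⁻¹)
    (hK : ∀ d, f d ∉ K → ∃ x, x ≠ r ∧ (c x).1 = d.1)
    (hprod : ∀ x, x ≠ r → f (c x) ∈ K ∨ ∃ l : List (Dart E), l.Nodup ∧ (∀ d, d ∈ l ↔ fc d = x) ∧
      (l.map f).prod ∈ K) (d : Dart E) : f d ∈ K := by
  classical
  have key : ∀ x, x ≠ r → f (c x) ∈ K := by
    by_contra! hcon
    -- Take a bad vertex of maximal rank. Any other bad edge at it would be the parent edge of a
    -- child, which is then bad and of larger rank; so its parent edge carries the only bad factor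
    -- of the product around it.
    obtain ⟨x, ⟨hxr, hxK⟩, hmax⟩ := Set.exists_max_image {x | x ≠ r ∧ f (c x) ∉ K} rank
      (Set.toFinite _) hcon
    rcases hprod x hxr with h | ⟨l, hl, hmem, hlK⟩
    · exact hxK h
    refine hxK (mem_of_list_prod_mem K f hl ((hmem _).2 (hc.source x hxr)) ?_ hlK)
    intro b hb hbx
    by_contra hbK
    obtain ⟨y, hyr, hyb⟩ := hK b hbK
    rcases eq_or_eq_flip hyb with rfl | h
    · rw [hmem, hc.source y hyr] at hb
      exact hbx (hb ▸ rfl)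
    · have hyK : f (c y) ∉ K := by rwa [h, hf, inv_mem_iff]
      have h1 := hmax y ⟨hyr, hyK⟩
      have h2 := hc.rank_lt y hyr
      rw [h, flip_flip, (hmem b).1 hb] at h2
      exact absurd h1 (not_le.mpr h2)
  by_contra hd
  obtain ⟨x, hxr, hxd⟩ := hK d hd
  rcases eq_or_eq_flip hxd with h | h
  · exact hd (h ▸ key x hxr)
  · have := key x hxr
    rw [h, hf, inv_mem_iff] at this
    exact hd this

end Tree

/-! ### Trees and complementary dual trees -/

namespace Lattice

variable {E : Type*} (Γ : Lattice E)

theorem next_apply (s : Dart E) : Γ.next s = flip (Γ.rot s) := rfl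

theorem vertex_eq_iff {d d' : Dart E} : Γ.vertex d = Γ.vertex d' ↔ Γ.rot.SameCycle d d' :=
  Quotient.eq

theorem face_eq_iff {d d' : Dart E} : Γ.face d = Γ.face d' ↔ Γ.next.SameCycle d d' :=
  Quotient.eq

@[simp] theorem vertex_rot (d : Dart E) : Γ.vertex (Γ.rot d) = Γ.vertex d :=
  Γ.vertex_eq_iff.2 (Equiv.Perm.SameCycle.refl _ _).apply_left

@[simp] theorem face_next (d : Dart E) : Γ.face (Γ.next d) = Γ.face d :=
  Γ.face_eq_iff.2 (Equiv.Perm.SameCycle.refl _ _).apply_left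

@[simp] theorem face_flip_rot (d : Dart E) : Γ.face (flip (Γ.rot d)) = Γ.face d := Γ.face_next d

theorem exists_vertex (v : Γ.Vertex) : ∃ d, Γ.vertex d = v := Quotient.exists_rep v

theorem exists_face (p : Γ.Face) : ∃ d, Γ.face d = p := Quotient.exists_rep p

/-- The permutations preserving `P` in both directions form a subgroup; the equivalences in the
hypotheses provide closure under inverses. -/
theorem induction_of_isPretransitive
    (h : MulAction.IsPretransitive (Subgroup.closure {Γ.rot, flip} : Subgroup (Equiv.Perm (Dart E)))
      (Dart E)) (P : Dart E → Prop) (hrot : ∀ d, P (Γ.rot d) ↔ P d) (hflip : ∀ d, P (flip d) ↔ P d)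
    (d₀ : Dart E) (h₀ : P d₀) (d : Dart E) : P d := by
  obtain ⟨⟨σ, hσ⟩, rfl⟩ := h.exists_smul_eq d₀ d
  change P (σ d₀)
  have : ∀ d, P (σ d) ↔ P d := by
    induction hσ using Subgroup.closure_induction with
    | mem τ hτ =>
      rcases hτ with rfl | rfl
      · exact hrot
      · exact hflip
    | one => exact fun _ => Iff.rfl
    | mul τ τ' _ _ h1 h2 => exact fun d => (h1 _).trans (h2 d)
    | inv τ _ h1 => exact fun d => by simpa using (h1 (τ⁻¹ d)).symm
  exact (this d₀).2 h₀

variable [Fintype E] [DecidableEq E]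

theorem exists_vertexTree
    (h : MulAction.IsPretransitive (Subgroup.closure {Γ.rot, flip} : Subgroup (Equiv.Perm (Dart E)))
      (Dart E)) (v₀ : Γ.Vertex) :
    ∃ rank c, IsTree Γ.vertex v₀ rank c := by
  obtain ⟨d₀, rfl⟩ := Γ.exists_vertex v₀
  obtain ⟨rank, c, hc, -⟩ := exists_isTree Γ.vertex (Γ.vertex d₀) (fun _ => True) ⟨d₀⟩ (by
    intro v
    obtain ⟨d, rfl⟩ := Γ.exists_vertex v
    refine Γ.induction_of_isPretransitive h (fun d => Relation.ReflTransGen _ (Γ.vertex d) (Γ.vertex d₀))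
      (fun d => by rw [vertex_rot]) (fun d => ⟨fun hd => ?_, fun hd => ?_⟩) d₀ .refl d
    · exact hd.head ⟨d, trivial, rfl, rfl⟩
    · exact hd.head ⟨flip d, trivial, rfl, by rw [flip_flip]⟩)
  exact ⟨rank, c, hc⟩

/-- The complement of a spanning tree connects the faces. -/
theorem exists_faceTree
    (h : MulAction.IsPretransitive (Subgroup.closure {Γ.rot, flip} : Subgroup (Equiv.Perm (Dart E)))
      (Dart E)) {v₀ : Γ.Vertex} {rank : Γ.Vertex → ℕ} {c : Γ.Vertex → Dart E}
    (hc : IsTree Γ.vertex v₀ rank c) (p₁ : Γ.Face) :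
    ∃ rank' c', IsTree Γ.face p₁ rank' c' ∧
      ∀ p, p ≠ p₁ → ∀ v, v ≠ v₀ → (c v).1 ≠ (c' p).1 := by
  classical
  obtain ⟨d₁, rfl⟩ := Γ.exists_face p₁
  obtain ⟨rank', c', hc', hal⟩ := exists_isTree Γ.face (Γ.face d₁)
    (fun d => ∀ v, v ≠ v₀ → (c v).1 ≠ d.1) ⟨d₁⟩ (by
    set R : Γ.Face → Γ.Face → Prop := fun x y => ∃ d : Dart E, (∀ v, v ≠ v₀ → (c v).1 ≠ d.1) ∧
      Γ.face d = x ∧ Γ.face (flip d) = y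
    -- `χ` marks the faces joined to the root without crossing the tree, as signs, so that its jump
    -- `f` across an edge is multiplicative. The jump lives on tree edges and its product around
    -- each vertex telescopes to 1; hence it vanishes everywhere and `χ` is constant by
    -- connectedness.
    let χ : Γ.Face → ℤˣ := fun p => if Relation.ReflTransGen R p (Γ.face d₁) then 1 else -1
    have hR : ∀ d : Dart E, (∀ v, v ≠ v₀ → (c v).1 ≠ d.1) →
        χ (Γ.face (flip d)) = χ (Γ.face d) := by
      intro d hd
      have : Relation.ReflTransGen R (Γ.face (flip d)) (Γ.face d₁) ↔
          Relation.ReflTransGen R (Γ.face d) (Γ.face d₁) :=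
        ⟨fun h => h.head ⟨d, hd, rfl, rfl⟩, fun h => h.head ⟨flip d, hd, rfl, by rw [flip_flip]⟩⟩
      simp only [χ, this]
    let f : Dart E → ℤˣ := fun d => χ (Γ.face d) * (χ (Γ.face (flip d)))⁻¹
    have hf : ∀ d, f d ∈ (⊥ : Subgroup ℤˣ) := by
      refine hc.mem_of_prod_mem ⊥ f (fun d => by simp [f, flip_flip]) (fun d hd => ?_)
        (fun v _ => Or.inr ⟨(Finset.univ.filter fun d => Γ.vertex d = v).toList,
          Finset.nodup_toList _, fun d => by simp, ?_⟩)
      · by_contra! hcon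
        exact hd (by simp [f, hR d hcon])
      · rw [Finset.prod_map_toList, Finset.prod_mul_distrib, Finset.prod_inv_distrib,
          Subgroup.mem_bot, mul_inv_eq_one]
        refine Finset.prod_nbij' Γ.rot Γ.rot.symm ?_ ?_ ?_ ?_ ?_
        · intro d hd
          simpa using hd
        · intro d hd
          rw [Finset.mem_filter] at hd ⊢
          rw [← hd.2, ← Γ.vertex_rot (Γ.rot.symm d), Equiv.apply_symm_apply]
          simp
        · simp
        · simp
        · intro d _
          rw [face_flip_rot]
    intro p
    obtain ⟨d, rfl⟩ := Γ.exists_face p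
    have hflip : ∀ d, χ (Γ.face (flip d)) = χ (Γ.face d) := fun d =>
      (mul_inv_eq_one.mp (hf d)).symm
    have : χ (Γ.face d) = 1 := Γ.induction_of_isPretransitive h (fun d => χ (Γ.face d) = 1)
      (fun d => by rw [← hflip, face_flip_rot]) (fun d => by rw [hflip]) d₁
      (by simp [χ, Relation.ReflTransGen.refl]) d
    by_contra hcon
    simp [χ, hcon] at this)
  exact ⟨rank', c', hc', fun p hp v hv => hal p hp v hv⟩

/-- On the sphere, every edge belongs to a spanning tree or to the complementary spanning tree of
the dual graph. -/
theorem IsPlanar.exists_tree_cotree {Γ : Lattice E} (hΓ : Γ.IsPlanar) (v₀ : Γ.Vertex)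
    (p₁ : Γ.Face) :
    ∃ rank c rank' c', IsTree Γ.vertex v₀ rank c ∧ IsTree Γ.face p₁ rank' c' ∧
      ∀ e, (∃ v, v ≠ v₀ ∧ (c v).1 = e) ∨ ∃ p, p ≠ p₁ ∧ (c' p).1 = e := by
  obtain ⟨rank, c, hc⟩ := Γ.exists_vertexTree hΓ.1 v₀
  obtain ⟨rank', c', hc', hcc'⟩ := Γ.exists_faceTree hΓ.1 hc p₁
  refine ⟨rank, c, rank', c', hc, hc', ?_⟩
  have h1 := hc.ncard_edges
  have h2 := hc'.ncard_edges
  have h3 := hΓ.2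
  set T := (fun v => (c v).1) '' {v | v ≠ v₀}
  set C := (fun p => (c' p).1) '' {p | p ≠ p₁}
  have hdisj : _root_.Disjoint T C := by
    rw [Set.disjoint_left]
    rintro _ ⟨v, hv, rfl⟩ ⟨p, hp, hpv⟩
    exact hcc' p hp v hv hpv.symm
  have huniv : T ∪ C = Set.univ := by
    -- The two disjoint trees have `|V| - 1` and `|F| - 1` edges, which by Euler's formula add up to
    -- `|E|`.
    refine Set.eq_of_subset_of_ncard_le (Set.subset_univ _) ?_
    rw [Set.ncard_union_eq hdisj, Set.ncard_univ]
    omega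
  intro e
  have he : e ∈ T ∪ C := huniv ▸ Set.mem_univ e
  exact he

end Lattice

/-! ### Gauge transformations and holonomies -/

section Along

variable {E G H : Type*} [Group G]

@[simp] theorem along_flip (x : E → G) (d : Dart E) : along x (flip d) = (along x d)⁻¹ := by
  obtain ⟨e, _ | _⟩ := d <;> simp [along, flip]

theorem along_comp [Group H] (φ : H →* G) (x : E → H) (d : Dart E) :
    along (fun e => φ (x e)) d = φ (along x d) := by
  obtain ⟨e, _ | _⟩ := d <;> simp [along]

theorem along_mul [CommGroup H] (x y : E → H) (d : Dart E) :
    along (x * y) d = along x d * along y d := by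
  obtain ⟨e, _ | _⟩ := d <;> simp [along, mul_comm]

theorem along_one (d : Dart E) : along (1 : E → G) d = 1 := by
  obtain ⟨e, _ | _⟩ := d <;> simp [along]

theorem along_eq_one {x : E → G} {d : Dart E} : along x d = 1 ↔ x d.1 = 1 := by
  obtain ⟨e, _ | _⟩ := d <;> simp [along]

theorem along_mem_iff {K : Subgroup G} {x : E → G} {d : Dart E} : along x d ∈ K ↔ x d.1 ∈ K := by
  obtain ⟨e, _ | _⟩ := d <;> simp [along]

theorem along_mulDart [CommGroup H] [DecidableEq E] (z : H) (d d' : Dart E) (x : E → H) :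
    along (mulDart z d x) d' =
      along x d' * ((if d' = d then z else 1) * if d' = flip d then z⁻¹ else 1) := by
  obtain ⟨e, b⟩ := d
  obtain ⟨e', b'⟩ := d'
  by_cases he : e' = e
  · subst he
    cases b <;> cases b' <;> simp [along, mulDart, flip, mul_comm]
  · simp [along, mulDart, flip, he]

end Along

namespace Lattice

variable {E : Type*} (Γ : Lattice E)

section Twist

variable {G H : Type*} [Group G]

/-- The gauge transformation by `k⁻¹`. -/
def twist (k : Γ.Vertex → G) (x : E → G) : E → G :=
  fun e => (k (Γ.vertex (e, true)))⁻¹ * x e * k (Γ.vertex (e, false))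

theorem along_twist (k : Γ.Vertex → G) (x : E → G) (d : Dart E) :
    along (Γ.twist k x) d = (k (Γ.vertex d))⁻¹ * along x d * k (Γ.vertex (flip d)) := by
  obtain ⟨e, _ | _⟩ := d <;> simp [along, flip, twist, mul_assoc]

theorem twist_twist (k k' : Γ.Vertex → G) (x : E → G) :
    Γ.twist k (Γ.twist k' x) = Γ.twist (k' * k) x := by
  funext e
  simp [twist, mul_assoc]

@[simp] theorem twist_one (x : E → G) : Γ.twist 1 x = x := by
  funext e
  simp [twist]

theorem twist_comp [Group H] (φ : H →* G) (k : Γ.Vertex → H) (x : E → H) :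
    Γ.twist (fun v => φ (k v)) (fun e => φ (x e)) = fun e => φ (Γ.twist k x e) := by
  funext e
  simp [twist]

theorem twist_const_conj (g : G) (k : Γ.Vertex → G) (x : E → G) :
    Γ.twist (fun v => g * k v) x = Γ.twist k (fun e => g⁻¹ * x e * g) := by
  funext e
  simp [twist, mul_assoc]

/-- In the abelian case gauge orbits are cosets, so comparing two connections reduces to
trivializing their quotient. -/
theorem twist_mul [CommGroup H] (k : Γ.Vertex → H) (x y : E → H) :
    Γ.twist k (x * y) = Γ.twist k x * y := by
  funext e
  simp only [twist, Pi.mul_apply]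
  rw [← mul_assoc, mul_right_comm]

/-- Along an edge, the gauge at one end and the two values of the connection determine the gauge at
the other end; connectedness spreads the agreement from `v₀`. -/
theorem twist_injective
    (h : MulAction.IsPretransitive (Subgroup.closure {Γ.rot, flip} : Subgroup (Equiv.Perm (Dart E)))
      (Dart E)) {x : E → G} {k k' : Γ.Vertex → G} {v₀ : Γ.Vertex} (h₀ : k v₀ = k' v₀)
    (hk : Γ.twist k x = Γ.twist k' x) : k = k' := by
  funext v
  obtain ⟨d₀, rfl⟩ := Γ.exists_vertex v₀
  obtain ⟨d, rfl⟩ := Γ.exists_vertex v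
  have key : ∀ d, k (Γ.vertex d) = k' (Γ.vertex d) →
      k (Γ.vertex (flip d)) = k' (Γ.vertex (flip d)) := by
    intro d hd
    have := Γ.along_twist k x d
    rw [hk, along_twist, hd] at this
    exact (mul_left_cancel this).symm
  refine Γ.induction_of_isPretransitive h (fun d => k (Γ.vertex d) = k' (Γ.vertex d))
    (fun d => by rw [vertex_rot]) (fun d => ⟨fun hd => ?_, key d⟩) d₀ h₀ d
  simpa [flip_flip] using key _ hd

end Twist

/-- The sites of a face, clockwise from `s`. -/
noncomputable def corners (s : Γ.Site) : List Γ.Site :=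
  (List.range (Function.minimalPeriod Γ.next s)).map fun i => (Γ.next)^[i] s

theorem boundary_eq (s : Γ.Site) : Γ.boundary s = (Γ.corners s).map Γ.rot := by
  rw [boundary, corners, List.map_map]
  rfl

theorem nodup_corners (s : Γ.Site) : (Γ.corners s).Nodup := by
  refine (List.nodup_map_iff_inj_on List.nodup_range).2 fun i hi j hj hij => ?_
  exact Function.iterate_injOn_Iio_minimalPeriod (by simpa using hi) (by simpa using hj) hij

theorem holonomy_eq {G : Type*} [Group G] (s : Γ.Site) (x : E → G) :
    Γ.holonomy s x = ((Γ.corners s).map fun t => along x (Γ.rot t)).prod := by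
  simp [holonomy, boundary_eq, Function.comp_def]

theorem holonomy_twist {G : Type*} [Group G] (s : Γ.Site) (k : Γ.Vertex → G) (x : E → G) :
    Γ.holonomy s (Γ.twist k x) = (k (Γ.vertex s))⁻¹ * Γ.holonomy s x * k (Γ.vertex s) := by
  -- The factors telescope along every initial segment of the boundary; after a full period the end
  -- vertex is the initial one.
  have key : ∀ n, ((List.range n).map fun i => along (Γ.twist k x) (Γ.rot (Γ.next^[i] s))).prod =
      (k (Γ.vertex s))⁻¹ * ((List.range n).map fun i => along x (Γ.rot (Γ.next^[i] s))).prod *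
        k (Γ.vertex (Γ.next^[n] s)) := by
    intro n
    induction n with
    | zero => simp
    | succ n ih =>
      rw [List.range_succ, List.map_append, List.prod_append, ih, List.map_append,
        List.prod_append, Function.iterate_succ_apply', next_apply]
      simp [along_twist, mul_assoc]
  have := key (Function.minimalPeriod Γ.next s)
  rw [Function.iterate_minimalPeriod] at this
  rw [holonomy_eq, holonomy_eq, corners, List.map_map, List.map_map]
  exact this

theorem holonomy_comp {G H : Type*} [Group G] [Group H] (φ : H →* G) (s : Γ.Site) (x : E → H) :
    Γ.holonomy s (fun e => φ (x e)) = φ (Γ.holonomy s x) := by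
  simp [holonomy_eq, map_list_prod, along_comp, Function.comp_def]

@[simp] theorem holonomy_one {G : Type*} [Group G] (s : Γ.Site) :
    Γ.holonomy s (1 : E → G) = 1 := by
  simp [holonomy_eq, along_one]

variable [Fintype E] [DecidableEq E]

theorem mem_corners {s t : Γ.Site} : t ∈ Γ.corners s ↔ Γ.face t = Γ.face s := by
  rw [eq_comm, face_eq_iff]
  constructor
  · intro h
    obtain ⟨i, -, rfl⟩ := List.mem_map.1 h
    rw [Equiv.Perm.iterate_eq_pow]
    exact ⟨i, by simp⟩
  · intro h
    obtain ⟨i, -, rfl⟩ := h.exists_pow_eq'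
    refine List.mem_map.2 ⟨i % Function.minimalPeriod Γ.next s, ?_, ?_⟩
    · rw [List.mem_range]
      exact Nat.mod_lt _ (Function.minimalPeriod_pos_of_mem_periodicPts
        (Function.Injective.mem_periodicPts Γ.next.injective s))
    · rw [Function.iterate_mod_minimalPeriod_eq, Equiv.Perm.iterate_eq_pow]

section Comm

variable {H : Type*} [CommGroup H]

open scoped Classical in
theorem holonomy_eq_prod (s : Γ.Site) (x : E → H) :
    Γ.holonomy s x = ∏ t with Γ.face t = Γ.face s, along x (Γ.rot t) := by
  rw [holonomy_eq, ← List.prod_toFinset _ (Γ.nodup_corners s)]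
  congr 1
  ext t
  simp [mem_corners]

theorem holonomy_congr {s t : Γ.Site} (h : Γ.face s = Γ.face t) (x : E → H) :
    Γ.holonomy s x = Γ.holonomy t x := by
  rw [holonomy_eq_prod, holonomy_eq_prod, h]

theorem holonomy_mul (s : Γ.Site) (x y : E → H) :
    Γ.holonomy s (x * y) = Γ.holonomy s x * Γ.holonomy s y := by
  simp [holonomy_eq_prod, along_mul, Finset.prod_mul_distrib]

theorem holonomy_inv (s : Γ.Site) (x : E → H) :
    Γ.holonomy s x⁻¹ = (Γ.holonomy s x)⁻¹ := by
  rw [eq_inv_iff_mul_eq_one, ← holonomy_mul, inv_mul_cancel, holonomy_one]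

-- The dart `rot s` bounds the face of `s`, and its reverse bounds the face of `rot s`. If the two
-- faces agree, the factors cancel.
open scoped Classical in
theorem holonomy_mulDart (s t : Γ.Site) (z : H) (x : E → H) :
    Γ.holonomy t (mulDart z (Γ.rot s) x) = Γ.holonomy t x *
      ((if Γ.face s = Γ.face t then z else 1) *
        if Γ.face (Γ.rot s) = Γ.face t then z⁻¹ else 1) := by
  have h1 : ∀ t', Γ.rot t' = flip (Γ.rot s) ↔ t' = Γ.rot.symm (flip (Γ.rot s)) := fun t' =>
    (Equiv.eq_symm_apply _).symm
  have h2 : Γ.face (Γ.rot.symm (flip (Γ.rot s))) = Γ.face (Γ.rot s) := by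
    rw [← face_flip_rot, Equiv.apply_symm_apply, flip_flip]
  simp only [holonomy_eq_prod, along_mulDart, Finset.prod_mul_distrib, Γ.rot.injective.eq_iff, h1,
    Finset.prod_ite_eq', Finset.mem_filter, Finset.mem_univ, true_and, h2]

end Comm

/-! ### Connections on the sphere that are flat off two faces -/

/-- Up to a gauge transformation, a connection on the sphere that is flat except at two faces takes
values in a cyclic group. -/
theorem IsPlanar.exists_twist_mem_zpowers {Γ : Lattice E} (hΓ : Γ.IsPlanar) {G : Type*} [Group G]
    (v₀ : Γ.Vertex) (p₀ p₁ : Γ.Face) (x : E → G)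
    (hx : ∀ t, Γ.face t ≠ p₀ → Γ.face t ≠ p₁ → Γ.holonomy t x = 1) :
    ∃ (k : Γ.Vertex → G) (x' : E → G) (h : G), k v₀ = 1 ∧ x = Γ.twist k x' ∧
      (∀ e, x' e ∈ Subgroup.zpowers h) ∧ (p₀ = p₁ → h = 1) := by
  classical
  obtain ⟨rank, c, rank', c', hc, hc', hcc'⟩ := hΓ.exists_tree_cotree v₀ p₁
  -- The recursion from the root is solved so that gauging by `k⁻¹` makes every tree edge trivial.
  obtain ⟨k, hk₀, hk⟩ := exists_of_parent v₀ rank (fun v => Γ.vertex (flip (c v))) hc.rank_lt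
    (1 : G) (fun v g => g * (along x (c v))⁻¹)
  set x' := Γ.twist k⁻¹ x with hx'
  have hxx' : x = Γ.twist k x' := by rw [hx', twist_twist, inv_mul_cancel, twist_one]
  have htree : ∀ v, v ≠ v₀ → x' (c v).1 = 1 := by
    intro v hv
    rw [← along_eq_one, hx', along_twist, hc.source v hv]
    simp [hk v hv]
  refine ⟨k, x', if p₀ = p₁ then 1 else along x' (flip (c' p₀)), hk₀, hxx', fun e => ?_,
    fun h => if_pos h⟩
  set K := Subgroup.zpowers (if p₀ = p₁ then 1 else along x' (flip (c' p₀)))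
  -- The darts `d` with a given face are the corners `next t = flip (rot t)`; the `flip` turns the
  -- product over them into the holonomy. At `p₀`, which need not be flat, the parent edge lies in
  -- `K` by the choice of generator.
  have := hc'.mem_of_prod_mem K (fun d => along x' (flip d)) (fun d => by simp)
    (fun d hd => ?_) (fun p hp => ?_) (e, true)
  · rwa [along_mem_iff] at this
  · refine (hcc' d.1).resolve_left ?_
    rintro ⟨v, hv, hvd⟩
    refine hd ?_
    rw [along_mem_iff]
    change x' d.1 ∈ K
    rw [← hvd, htree v hv]
    exact K.one_mem
  · by_cases hp₀ : p = p₀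
    · left
      subst hp₀
      simp only [K, if_neg hp]
      exact Subgroup.mem_zpowers _
    · right
      obtain ⟨s, rfl⟩ := Γ.exists_face p
      refine ⟨(Γ.corners s).map Γ.next, (Γ.nodup_corners s).map Γ.next.injective, fun d => ?_, ?_⟩
      · rw [List.mem_map]
        constructor
        · rintro ⟨t, ht, rfl⟩
          rw [face_next, Γ.mem_corners.1 ht]
        · intro hd
          refine ⟨Γ.next.symm d, Γ.mem_corners.2 ?_, Equiv.apply_symm_apply _ _⟩
          rw [← hd, ← Γ.face_next (Γ.next.symm d), Equiv.apply_symm_apply]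
      · have h1 : Γ.holonomy s x' = 1 := by
          rw [hx', holonomy_twist, hx s hp₀ hp]
          simp
        rw [holonomy_eq] at h1
        simp only [List.map_map, Function.comp_def, next_apply, flip_flip, h1]
        exact K.one_mem

/-- A flat connection on the sphere is trivial; it suffices that it is flat except at one face. -/
theorem IsPlanar.exists_eq_twist_one {Γ : Lattice E} (hΓ : Γ.IsPlanar) {G : Type*} [Group G]
    (v₀ : Γ.Vertex) (p₁ : Γ.Face) (x : E → G) (hx : ∀ t, Γ.face t ≠ p₁ → Γ.holonomy t x = 1) :
    ∃ k : Γ.Vertex → G, k v₀ = 1 ∧ x = Γ.twist k 1 := by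
  obtain ⟨k, x', h, hk, hxk, hx', hh⟩ :=
    hΓ.exists_twist_mem_zpowers v₀ p₁ p₁ x (fun t ht _ => hx t ht)
  refine ⟨k, hk, hxk.trans ?_⟩
  congr 1
  funext e
  simpa [hh rfl] using hx' e

/-- A connection with values in an abelian group is determined up to gauge transformations by its
holonomies at all faces but one. -/
theorem IsPlanar.exists_eq_twist {Γ : Lattice E} (hΓ : Γ.IsPlanar) {H : Type*} [CommGroup H]
    (v₀ : Γ.Vertex) (p₁ : Γ.Face) (x y : E → H)
    (hxy : ∀ t, Γ.face t ≠ p₁ → Γ.holonomy t x = Γ.holonomy t y) :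
    ∃ k : Γ.Vertex → H, k v₀ = 1 ∧ x = Γ.twist k y := by
  obtain ⟨k, hk, h⟩ := hΓ.exists_eq_twist_one v₀ p₁ (x * y⁻¹) (fun t ht => by
    rw [holonomy_mul, holonomy_inv, hxy t ht, mul_inv_cancel])
  refine ⟨k, hk, ?_⟩
  have := Γ.twist_mul k 1 y
  rw [one_mul] at this
  rw [this, ← h, inv_mul_cancel_right]

open scoped Classical in
/-- A connection on the sphere that is flat except at the faces of two sites is the image of an
integral one, up to a gauge transformation. -/
theorem IsPlanar.exists_eq_twist_zpow {Γ : Lattice E} (hΓ : Γ.IsPlanar) {G : Type*} [Group G]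
    (v₀ : Γ.Vertex) (s₀ s₁ : Γ.Site) (a : E → Multiplicative ℤ)
    (ha : ∀ t, Γ.holonomy t a = (if Γ.face s₀ = Γ.face t then Multiplicative.ofAdd 1 else 1) *
      if Γ.face s₁ = Γ.face t then (Multiplicative.ofAdd 1)⁻¹ else 1)
    (x : E → G)
    (hx : ∀ t, Γ.face t ≠ Γ.face s₀ → Γ.face t ≠ Γ.face s₁ → Γ.holonomy t x = 1) :
    ∃ (k : Γ.Vertex → G) (h : G), k v₀ = 1 ∧
      x = Γ.twist k (fun e => zpowersHom G h (a e)) := by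
  obtain ⟨k, x', h, hk, rfl, hx', hh⟩ := hΓ.exists_twist_mem_zpowers v₀ _ _ x hx
  by_cases hp : Γ.face s₀ = Γ.face s₁
  · refine ⟨k, 1, hk, ?_⟩
    congr 1
    funext e
    simpa [hh hp] using hx' e
  let : CommGroup (Subgroup.zpowers h) :=
    { (inferInstance : Group (Subgroup.zpowers h)) with
      mul_comm := fun a b => by
        obtain ⟨_, m, rfl⟩ := a
        obtain ⟨_, n, rfl⟩ := b
        exact Subtype.ext (zpow_mul_comm h m n) }
  let z : E → Subgroup.zpowers h := fun e => ⟨x' e, hx' e⟩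
  let ι : Subgroup.zpowers h →* G := (Subgroup.zpowers h).subtype
  have hz : x' = fun e => ι (z e) := rfl
  -- The flux `w` need not be the generator `h`. It is chosen so that `z` and `w ^ a` have the same
  -- holonomies off the face of `s₁`.
  let w := Γ.holonomy s₀ z
  obtain ⟨c, hc, hcz⟩ := hΓ.exists_eq_twist v₀ (Γ.face s₁) z (fun e => zpowersHom _ w (a e)) (by
    intro t ht
    rw [holonomy_comp, ha, if_neg (Ne.symm ht), mul_one]
    split_ifs with hts
    · rw [zpowersHom_apply]
      simp [w, Γ.holonomy_congr hts]
    · rw [map_one]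
      have h1 : Γ.holonomy t x' = 1 := by
        have := hx t (Ne.symm hts) ht
        rw [holonomy_twist, mul_eq_one_iff_eq_inv, mul_eq_left] at this
        exact this
      rw [hz, holonomy_comp] at h1
      exact Subtype.ext h1)
  refine ⟨(fun v => ι (c v)) * k, ι w, by simp [hc, hk], ?_⟩
  rw [← twist_twist, hz, hcz, ← Γ.twist_comp ι]
  rfl

end Lattice

namespace Lattice

/-! ### Running along a ribbon -/

variable {E : Type*} [DecidableEq E] (Γ : Lattice E)

/-- Run along a sequence of triangles with flux `h` on the connection `x`: the resulting connection
and the group element recorded along the direct triangles. -/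
def run {G : Type*} [Group G] : Γ.Site → List Triangle → G → (E → G) → (E → G) × G
  | _, [], _, x => (x, 1)
  | s, .direct :: w, h, x =>
      let f := along x (Γ.rot s)
      ((run (Γ.step s .direct) w (f⁻¹ * h * f) x).1,
        f * (run (Γ.step s .direct) w (f⁻¹ * h * f) x).2)
  | s, .dual :: w, h, x => run (Γ.step s .dual) w h (mulDart h (Γ.rot s) x)

section Abelian

variable {G H : Type*} [Group G] [CommGroup H]

/-- The flux is read in the frame at the vertex of `d`, hence conjugated by the gauge there; the
gauge at the other end of the edge plays no part. -/
theorem mulDart_twist_comp (φ : H →* G) (z : H) (k : Γ.Vertex → G) (a : E → H) (d : Dart E) :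
    mulDart ((k (Γ.vertex d))⁻¹ * φ z * k (Γ.vertex d)) d (Γ.twist k fun e => φ (a e)) =
      Γ.twist k fun e => φ (mulDart z d a e) := by
  funext e
  obtain ⟨e', b⟩ := d
  by_cases he : e = e'
  · subst he
    cases b <;> simp [mulDart, twist, mul_assoc]
  · simp [mulDart, twist, he]

/-- Runs on gauge transforms of connections with values in an abelian group. -/
theorem run_twist_comp (φ : H →* G) (z : H) (k : Γ.Vertex → G) (w : List Triangle) :
    ∀ (s : Γ.Site) (a : E → H),
      Γ.run s w ((k (Γ.vertex s))⁻¹ * φ z * k (Γ.vertex s)) (Γ.twist k fun e => φ (a e)) =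
        (Γ.twist k fun e => φ ((Γ.run s w z a).1 e),
          (k (Γ.vertex s))⁻¹ * φ (Γ.run s w z a).2 * k (Γ.vertex (Γ.endSite s w))) := by
  induction w with
  | nil => simp [run, endSite]
  | cons t w ih =>
    intro s a
    cases t with
    | direct =>
      have h1 : along (Γ.twist k fun e => φ (a e)) (Γ.rot s) =
          (k (Γ.vertex s))⁻¹ * φ (along a (Γ.rot s)) * k (Γ.vertex (flip (Γ.rot s))) := by
        rw [along_twist, along_comp, vertex_rot]
      have h2 : ((k (Γ.vertex s))⁻¹ * φ (along a (Γ.rot s)) * k (Γ.vertex (flip (Γ.rot s))))⁻¹ *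
          ((k (Γ.vertex s))⁻¹ * φ z * k (Γ.vertex s)) *
          ((k (Γ.vertex s))⁻¹ * φ (along a (Γ.rot s)) * k (Γ.vertex (flip (Γ.rot s)))) =
          (k (Γ.vertex (Γ.step s .direct)))⁻¹ * φ z * k (Γ.vertex (Γ.step s .direct)) := by
        -- Conjugation by the walked element does not affect an abelian flux, so only the frame
        -- moves to the next vertex.
        have h3 : φ z = (φ (along a (Γ.rot s)))⁻¹ * φ z * φ (along a (Γ.rot s)) := by
          rw [← map_inv, ← map_mul, ← map_mul, mul_right_comm, inv_mul_cancel, one_mul]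
        conv_rhs => rw [h3]
        simp only [step]
        group
      have h4 : (along a (Γ.rot s))⁻¹ * z * along a (Γ.rot s) = z := by
        rw [mul_right_comm, inv_mul_cancel, one_mul]
      simp only [run, h1, h2, h4, ih, endSite, map_mul, Prod.mk.injEq, true_and]
      simp only [step]
      group
    | dual =>
      have h1 := Γ.mulDart_twist_comp φ z k a (Γ.rot s)
      rw [vertex_rot] at h1
      have h2 := ih (Γ.step s .dual) (mulDart z (Γ.rot s) a)
      simp only [step, vertex_rot] at h2
      simp only [run, h1, endSite, step, h2]

open scoped Classical in
/-- A run creates opposite fluxes at the faces of its end sites. -/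
theorem holonomy_run [Fintype E] (z : H) (t : Γ.Site) (w : List Triangle) :
    ∀ (s : Γ.Site) (a : E → H), Γ.holonomy t (Γ.run s w z a).1 = Γ.holonomy t a *
      ((if Γ.face s = Γ.face t then z else 1) *
        if Γ.face (Γ.endSite s w) = Γ.face t then z⁻¹ else 1) := by
  induction w with
  | nil =>
    intro s a
    change Γ.holonomy t a = Γ.holonomy t a *
      ((if Γ.face s = Γ.face t then z else 1) * if Γ.face s = Γ.face t then z⁻¹ else 1)
    split_ifs <;> simp
  | cons τ w ih =>
    intro s a
    cases τ with
    | direct =>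
      have h4 : (along a (Γ.rot s))⁻¹ * z * along a (Γ.rot s) = z := by
        rw [mul_right_comm, inv_mul_cancel, one_mul]
      rw [run, h4, ih, step, face_flip_rot]
      rfl
    | dual =>
      rw [run, ih, step, holonomy_mulDart]
      change _ = Γ.holonomy t a * ((if Γ.face s = Γ.face t then z else 1) *
        if Γ.face (Γ.endSite (Γ.rot s) w) = Γ.face t then z⁻¹ else 1)
      split_ifs <;> simp

end Abelian

/-! ### Self-crossings and homotopy -/

section Crossing

variable {G : Type*} [Group G]

theorem run_fst_apply (e : E) (w : List Triangle) :
    ∀ (s : Γ.Site) (h : G) (x : E → G), (∀ d ∈ Γ.crossed s w, e ≠ d.1) →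
      (Γ.run s w h x).1 e = x e := by
  induction w with
  | nil => simp [run]
  | cons t w ih =>
    intro s h x hd
    cases t with
    | direct => exact ih _ _ _ hd
    | dual =>
      simp only [crossed, List.forall_mem_cons] at hd
      rw [run, ih _ _ _ hd.2]
      simp [mulDart, hd.1]

/-- A run changes only crossed edges, so without self-crossings each walked edge still has its
initial trivial value. -/
theorem run_snd_eq_one (w : List Triangle) :
    ∀ (s : Γ.Site) (h : G) (x : E → G),
      (∀ d ∈ Γ.walked s w, ∀ d' ∈ Γ.crossed s w, d.1 ≠ d'.1) →
      (∀ d ∈ Γ.walked s w, x d.1 = 1) → (Γ.run s w h x).2 = 1 := by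
  induction w with
  | nil => simp [run]
  | cons t w ih =>
    intro s h x hd hx
    cases t with
    | direct =>
      simp only [walked, crossed, List.forall_mem_cons] at hd hx
      rw [run, ih _ _ _ hd.2 hx.2]
      simpa [along_eq_one] using hx.1
    | dual =>
      simp only [walked, crossed, List.forall_mem_cons] at hd hx
      rw [run, ih _ _ _ (fun d hdw => (hd d hdw).2)]
      intro d hdw
      simp [mulDart, (hd d hdw).1, hx d hdw]

theorem prod_walked_twist (k : Γ.Vertex → G) (x : E → G) (w : List Triangle) :
    ∀ s : Γ.Site, ((Γ.walked s w).map (along (Γ.twist k x))).prod =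
      (k (Γ.vertex s))⁻¹ * ((Γ.walked s w).map (along x)).prod *
        k (Γ.vertex (Γ.endSite s w)) := by
  induction w with
  | nil => simp [walked, endSite]
  | cons t w ih =>
    intro s
    cases t with
    | direct => simp [walked, endSite, ih, along_twist, step, mul_assoc]
    | dual => simp [walked, endSite, ih, step]

/-- Spurs cancel, and the inserted boundaries have trivial holonomy. -/
theorem Homotopic.prod_eq {P : Set Γ.Face} {v : Γ.Vertex} {u u' : List (Dart E)}
    (h : Γ.Homotopic P v u u') (x : E → G) (hx : ∀ s, Γ.face s ∉ P → Γ.holonomy s x = 1) :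
    (u.map (along x)).prod = (u'.map (along x)).prod := by
  induction h with
  | refl => rfl
  | symm _ ih => exact ih.symm
  | trans _ _ ih ih' => exact ih.trans ih'
  | spur => simp
  | face u u' s _ hP =>
    have := hx s hP
    rw [holonomy] at this
    simp [this]

end Crossing

variable {Γ}

/-- The integral connection created by a ribbon. -/
def Ribbon.cochain {s₀ s₁ : Γ.Site} (ξ : Γ.Ribbon s₀ s₁) : E → Multiplicative ℤ :=
  (Γ.run s₀ ξ.1 (Multiplicative.ofAdd 1) 1).1

/-- The signed number of times that a ribbon walks along edges that it has crossed before. -/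
def Ribbon.winding {s₀ s₁ : Γ.Site} (ξ : Γ.Ribbon s₀ s₁) : Multiplicative ℤ :=
  (Γ.run s₀ ξ.1 (Multiplicative.ofAdd 1) 1).2

open scoped Classical in
theorem Ribbon.holonomy_cochain [Fintype E] {s₀ s₁ : Γ.Site} (ξ : Γ.Ribbon s₀ s₁) (t : Γ.Site) :
    Γ.holonomy t ξ.cochain = (if Γ.face s₀ = Γ.face t then Multiplicative.ofAdd 1 else 1) *
      if Γ.face s₁ = Γ.face t then (Multiplicative.ofAdd 1)⁻¹ else 1 := by
  rw [cochain, holonomy_run, holonomy_one, one_mul, ξ.2]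

theorem Ribbon.NonSelfCrossing.winding_eq_one {s₀ s₁ : Γ.Site} {ξ : Γ.Ribbon s₀ s₁}
    (hξ : ξ.NonSelfCrossing) : ξ.winding = 1 :=
  Γ.run_snd_eq_one _ _ _ _ hξ fun _ _ => rfl

theorem Ribbon.NonSelfCrossing.prod_walked_cochain {s₀ s₁ : Γ.Site} {ξ : Γ.Ribbon s₀ s₁}
    (hξ : ξ.NonSelfCrossing) : ((Γ.walked s₀ ξ.1).map (along ξ.cochain)).prod = 1 := by
  refine List.prod_eq_one fun y hy => ?_
  obtain ⟨d, hd, rfl⟩ := List.mem_map.1 hy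
  rw [along_eq_one, Ribbon.cochain, run_fst_apply _ _ _ _ _ _ (hξ d hd)]
  rfl

/-- Any two ribbons with the same end sites create the same connection up to gauge
transformations. -/
theorem IsPlanar.exists_cochain_eq_twist [Fintype E] (hΓ : Γ.IsPlanar) {s₀ s₁ : Γ.Site}
    (ξ ξ' : Γ.Ribbon s₀ s₁) :
    ∃ c : Γ.Vertex → Multiplicative ℤ, c (Γ.vertex s₀) = 1 ∧
      ξ'.cochain = Γ.twist c ξ.cochain :=
  hΓ.exists_eq_twist _ (Γ.face s₁) _ _ fun t _ => by
    rw [ξ.holonomy_cochain, ξ'.holonomy_cochain]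

/-- Each cochain is trivial along its own ribbon, so `c` at the end is the inverse of the product of
`ξ.cochain` along the path of `ξ'`. That product equals the one along `ξ`, which is 1, by homotopy
invariance; or, if the end faces agree, because the fluxes cancel and the flat cochain has
path-independent products. If the end vertices agree, `hc` suffices. -/
theorem IsPlanar.twist_eq_one_of_nonSelfCrossing [Fintype E] (hΓ : Γ.IsPlanar) {s₀ s₁ : Γ.Site}
    {ξ ξ' : Γ.Ribbon s₀ s₁} (hξ : ξ.NonSelfCrossing) (hξ' : ξ'.NonSelfCrossing)
    (h : ξ.Homotopic ξ' ∨ ¬ Γ.Disjoint s₀ s₁) {c : Γ.Vertex → Multiplicative ℤ}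
    (hc : c (Γ.vertex s₀) = 1) (hξξ' : ξ'.cochain = Γ.twist c ξ.cochain) :
    c (Γ.vertex s₁) = 1 := by
  have h1 := Γ.prod_walked_twist c ξ.cochain ξ'.1 s₀
  rw [← hξξ', hξ'.prod_walked_cochain, hc, ξ'.2] at h1
  suffices ((Γ.walked s₀ ξ.1).map (along ξ.cochain)).prod =
      ((Γ.walked s₀ ξ'.1).map (along ξ.cochain)).prod ∨ Γ.vertex s₀ = Γ.vertex s₁ by
    rcases this with this | this
    · rw [← this, hξ.prod_walked_cochain] at h1
      simpa using h1.symm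
    · rw [← this, hc]
  rcases h with h | h
  · refine Or.inl (Homotopic.prod_eq Γ h _ fun s hs => ?_)
    simp only [Set.mem_insert_iff, Set.mem_singleton_iff, not_or] at hs
    rw [ξ.holonomy_cochain, if_neg (Ne.symm hs.1), if_neg (Ne.symm hs.2), one_mul]
  · by_cases hv : Γ.vertex s₀ = Γ.vertex s₁
    · exact Or.inr hv
    · have hp : Γ.face s₀ = Γ.face s₁ := by
        by_contra hp
        exact h ⟨hv, hp⟩
      obtain ⟨b, -, hb⟩ := hΓ.exists_eq_twist_one (Γ.vertex s₀) (Γ.face s₁) ξ.cochain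
        fun t ht => by
          rw [ξ.holonomy_cochain, hp, if_neg (Ne.symm ht), if_neg (Ne.symm ht), one_mul]
      left
      rw [hb, prod_walked_twist, prod_walked_twist, ξ.2, ξ'.2]
      simp [along_one, List.prod_eq_one]

end Lattice

/-! ### Operators on basis vectors -/

section Ket

variable {G E : Type*} [Group G] [Fintype G] [DecidableEq G] [Fintype E] [DecidableEq E]

@[simp] theorem opOfKets_ket (f : (E → G) → Hilb E G) (x : E → G) : opOfKets f (ket x) = f x := by
  have := (EuclideanSpace.basisFun (E → G) ℂ).toBasis.constr_basis ℂ f x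
  simp only [OrthonormalBasis.coe_toBasis, EuclideanSpace.basisFun_apply] at this
  exact this

theorem sum_smul_ket (ψ : Hilb E G) : ∑ x, ψ x • ket x = ψ := by
  have := (EuclideanSpace.basisFun (E → G) ℂ).sum_repr ψ
  simpa [ket] using this

theorem opOfKets_apply (f : (E → G) → Hilb E G) (ψ : Hilb E G) :
    opOfKets f ψ = ∑ x, ψ x • f x := by
  conv_lhs => rw [← sum_smul_ket ψ]
  simp

theorem hom_ext_ket {V : Type*} [AddCommMonoid V] [Module ℂ V] {f g : Hilb E G →ₗ[ℂ] V}
    (h : ∀ x, f (ket x) = g (ket x)) : f = g := by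
  ext ψ
  rw [← sum_smul_ket ψ]
  simp [h]

end Ket

namespace Lattice

variable {G E : Type*} [Group G] [Fintype G] [DecidableEq G] [Fintype E] [DecidableEq E]
  (Γ : Lattice E)

@[simp] theorem vertexAct_ket (v : Γ.Vertex) (h : G) (x : E → G) :
    Γ.vertexAct v h (ket x) = ket (Γ.gauge v h x) := opOfKets_ket _ _

@[simp] theorem faceAct_ket (s : Γ.Site) (g : G) (x : E → G) :
    Γ.faceAct s g (ket x) = if Γ.holonomy s x = g then ket x else 0 := opOfKets_ket _ _

/-- In the composition sum only the `f` recorded by the first triangle contributes. -/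
theorem ribbonOpAux_ket (w : List Triangle) : ∀ (s : Γ.Site) (h g : G) (x : E → G),
    Γ.ribbonOpAux s w h g (ket x) =
      if (Γ.run s w h x).2 = g then ket (Γ.run s w h x).1 else 0 := by
  induction w with
  | nil =>
    intro s h g x
    by_cases hg : g = 1
    · simp [ribbonOpAux, run, hg]
    · simp [ribbonOpAux, run, hg, Ne.symm hg]
  | cons t w ih =>
    intro s h g x
    cases t with
    | direct =>
      rw [ribbonOpAux, LinearMap.sum_apply, Finset.sum_eq_single (along x (Γ.rot s))]
      · simp only [triangleOp, LinearMap.comp_apply, opOfKets_ket, if_true, ih, run,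
          eq_inv_mul_iff_mul_eq]
        rfl
      · intro f _ hf
        simp [triangleOp, Ne.symm hf]
      · simp
    | dual =>
      rw [ribbonOpAux, LinearMap.sum_apply, Finset.sum_eq_single 1]
      · simp only [triangleOp, LinearMap.comp_apply, opOfKets_ket, if_true, ih, run, inv_one,
          one_mul, mul_one]
        rfl
      · intro f _ hf
        simp [triangleOp, hf]
      · simp

end Lattice

namespace Lattice

/-! ### The states created by ribbons -/

variable {G E : Type*} [Group G] [Fintype G] [DecidableEq G] [Fintype E] [DecidableEq E]
  (Γ : Lattice E)

noncomputable instance fintypeVertex : Fintype Γ.Vertex := Fintype.ofFinite _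

noncomputable instance decidableEqVertex : DecidableEq Γ.Vertex := Classical.decEq _

theorem gauge_eq_twist (v : Γ.Vertex) (h : G) (x : E → G) :
    Γ.gauge v h x = Γ.twist (Pi.mulSingle v h⁻¹) x := by
  funext e
  simp only [gauge, twist, Pi.mulSingle_apply]
  split_ifs <;> simp

/-- The operator of the gauge transformation by `k⁻¹`. -/
noncomputable def twistOp (k : Γ.Vertex → G) : Hilb E G →ₗ[ℂ] Hilb E G :=
  opOfKets fun x => ket (Γ.twist k x)

@[simp] theorem twistOp_ket (k : Γ.Vertex → G) (x : E → G) :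
    Γ.twistOp k (ket x) = ket (Γ.twist k x) := opOfKets_ket _ _

theorem twistOp_one : Γ.twistOp (1 : Γ.Vertex → G) = LinearMap.id :=
  hom_ext_ket fun x => by simp

theorem twistOp_twistOp (k k' : Γ.Vertex → G) (ψ : Hilb E G) :
    Γ.twistOp k (Γ.twistOp k' ψ) = Γ.twistOp (k' * k) ψ := by
  have : Γ.twistOp k ∘ₗ Γ.twistOp k' = Γ.twistOp (k' * k) :=
    hom_ext_ket fun x => by simp [twist_twist]
  exact LinearMap.congr_fun this ψ

theorem vertexAct_eq_twistOp (v : Γ.Vertex) (h : G) :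
    Γ.vertexAct v h = Γ.twistOp (Pi.mulSingle v h⁻¹) :=
  hom_ext_ket fun x => by simp [gauge_eq_twist]

theorem vertexAct_vertexAct (v : Γ.Vertex) (h h' : G) (ψ : Hilb E G) :
    Γ.vertexAct v h (Γ.vertexAct v h' ψ) = Γ.vertexAct v (h * h') ψ := by
  rw [vertexAct_eq_twistOp, vertexAct_eq_twistOp, vertexAct_eq_twistOp, twistOp_twistOp,
    ← Pi.mulSingle_mul, mul_inv_rev]

theorem A_apply (v : Γ.Vertex) (ψ : Hilb E G) :
    Γ.A v ψ = (Fintype.card G : ℂ)⁻¹ • ∑ h : G, Γ.vertexAct v h ψ := by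
  simp [A]

/-- `A v` is the average over the group acting at `v`, so its fixed vectors are the invariant ones.
-/
theorem A_eq_self_iff (v : Γ.Vertex) (ψ : Hilb E G) :
    Γ.A v ψ = ψ ↔ ∀ h, Γ.vertexAct v h ψ = ψ := by
  constructor
  · intro hψ h
    rw [← hψ, A_apply, map_smul, map_sum]
    congr 1
    simp only [vertexAct_vertexAct]
    exact Fintype.sum_equiv (Equiv.mulLeft h) _ _ fun _ => rfl
  · intro hψ
    rw [A_apply, Finset.sum_congr rfl fun h _ => hψ h, Finset.sum_const, Finset.card_univ,
      ← Nat.cast_smul_eq_nsmul ℂ, inv_smul_smul₀]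
    exact_mod_cast Fintype.card_ne_zero

theorem faceAct_apply (s : Γ.Site) (g : G) (ψ : Hilb E G) (x : E → G) :
    Γ.faceAct s g ψ x = if Γ.holonomy s x = g then ψ x else 0 := by
  rw [faceAct, opOfKets_apply, WithLp.ofLp_sum, Finset.sum_apply, Finset.sum_eq_single x]
  · split_ifs <;> simp [ket]
  · intro y _ hy
    split_ifs <;> simp [ket, hy.symm]
  · simp

/-- The sum of all gauge transforms, with a fixed gauge at two vertices, of the connection with
values in the powers of `h` that is given by an integral connection. -/
noncomputable def orbitState (v₀ v₁ : Γ.Vertex) (h : G) (a : E → Multiplicative ℤ) (u : G) :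
    Hilb E G :=
  ∑ k : Γ.Vertex → G,
    if k v₀ = 1 ∧ k v₁ = u then ket (Γ.twist k fun e => zpowersHom G h (a e)) else 0

variable (v₀ v₁ : Γ.Vertex) (h u : G) (a : E → Multiplicative ℤ)

/-- An integral gauge transformation is absorbed by left multiplication of the summation variable;
it shows only in the prescribed value at `v₁`. -/
theorem orbitState_twist (c : Γ.Vertex → Multiplicative ℤ) (hc : c v₀ = 1) :
    Γ.orbitState v₀ v₁ h (Γ.twist c a) u = Γ.orbitState v₀ v₁ h a (zpowersHom G h (c v₁) * u) := by
  refine Fintype.sum_equiv (Equiv.mulLeft fun v => zpowersHom G h (c v)) _ _ fun k => ?_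
  simp only [Equiv.coe_mulLeft, ← twist_comp, twist_twist, Pi.mul_apply, hc, map_one, one_mul,
    mul_right_inj]

theorem twistOp_orbitState (k' : Γ.Vertex → G) (h₀ : k' v₀ = 1) :
    Γ.twistOp k' (Γ.orbitState v₀ v₁ h a u) = Γ.orbitState v₀ v₁ h a (u * k' v₁) := by
  rw [orbitState, map_sum]
  refine Fintype.sum_equiv (Equiv.mulRight k') _ _ fun k => ?_
  simp only [Equiv.coe_mulRight, Pi.mul_apply, h₀, mul_one, mul_left_inj, ← twist_twist]
  split_ifs <;> simp

theorem vertexAct_orbitState_right (hv : v₀ ≠ v₁) (f : G) :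
    Γ.vertexAct v₁ f (Γ.orbitState v₀ v₁ h a u) = Γ.orbitState v₀ v₁ h a (u * f⁻¹) := by
  rw [vertexAct_eq_twistOp, twistOp_orbitState _ _ _ _ _ _ _ (by simp [hv]), Pi.mulSingle_eq_same]

theorem vertexAct_orbitState_of_ne (v : Γ.Vertex) (h₀ : v ≠ v₀) (h₁ : v ≠ v₁) (f : G) :
    Γ.vertexAct v f (Γ.orbitState v₀ v₁ h a u) = Γ.orbitState v₀ v₁ h a u := by
  rw [vertexAct_eq_twistOp, twistOp_orbitState _ _ _ _ _ _ _ (by simp [h₀.symm])]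
  simp [h₁.symm]

theorem vertexAct_orbitState_left (hv : v₀ ≠ v₁) (f : G) :
    Γ.vertexAct v₀ f (Γ.orbitState v₀ v₁ h a u) =
      Γ.orbitState v₀ v₁ (f * h * f⁻¹) a (f * u) := by
  rw [vertexAct_eq_twistOp, orbitState, map_sum]
  -- Acting at `v₀` breaks the normalization `k v₀ = 1`. Left multiplication by the constant `f`
  -- restores it, at the price of conjugating the flux.
  refine Fintype.sum_equiv ((Equiv.mulRight (Pi.mulSingle v₀ f⁻¹)).trans
    (Equiv.mulLeft fun _ => f)) _ _ fun k => ?_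
  have h1 : (fun _ => f) * (k * Pi.mulSingle v₀ f⁻¹) =
      fun v => f * (k * Pi.mulSingle v₀ f⁻¹ : Γ.Vertex → G) v := rfl
  have h2 : (fun e => f⁻¹ * zpowersHom G (f * h * f⁻¹) (a e) * f) =
      fun e => zpowersHom G h (a e) := by
    funext e
    rw [zpowersHom_apply, zpowersHom_apply, conj_zpow]
    simp [mul_assoc]
  have h3 : f * (k v₀ * f⁻¹) = 1 ↔ k v₀ = 1 := by
    rw [← mul_assoc, mul_inv_eq_one, mul_eq_left]
  simp only [Equiv.trans_apply, Equiv.coe_mulRight, Equiv.coe_mulLeft, h1, twist_const_conj, h2,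
    Pi.mul_apply, Pi.mulSingle_eq_same, h3, Pi.mulSingle_eq_of_ne hv.symm, mul_one, mul_right_inj]
  split_ifs
  · rw [twistOp_ket, twist_twist]
    rfl
  · exact map_zero _

theorem faceAct_orbitState {s : Γ.Site} {g : G}
    (hg : ∀ k : Γ.Vertex → G, k v₀ = 1 → k v₁ = u →
      Γ.holonomy s (Γ.twist k fun e => zpowersHom G h (a e)) = g) (f : G) :
    Γ.faceAct s f (Γ.orbitState v₀ v₁ h a u) =
      if f = g then Γ.orbitState v₀ v₁ h a u else 0 := by
  rw [orbitState, map_sum]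
  split_ifs with hf
  · subst hf
    refine Finset.sum_congr rfl fun k _ => ?_
    split_ifs with hk
    · rw [faceAct_ket, if_pos (hg k hk.1 hk.2)]
    · exact map_zero _
  · refine Finset.sum_eq_zero fun k _ => ?_
    split_ifs with hk
    · rw [faceAct_ket, if_neg (fun hh => hf (hh.symm.trans (hg k hk.1 hk.2)))]
    · exact map_zero _

theorem inner_orbitState (ψ : Hilb E G) :
    ⟪Γ.orbitState v₀ v₁ h a u, ψ⟫_ℂ = ∑ k : Γ.Vertex → G,
      if k v₀ = 1 ∧ k v₁ = u then ψ (Γ.twist k fun e => zpowersHom G h (a e)) else 0 := by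
  rw [orbitState, sum_inner]
  refine Finset.sum_congr rfl fun k _ => ?_
  split_ifs
  · rw [ket, EuclideanSpace.inner_single_left]
    simp
  · exact inner_zero_left _

theorem orbitState_apply (x : E → G) :
    Γ.orbitState v₀ v₁ h a u x = ((Finset.univ.filter fun k : Γ.Vertex → G => (k v₀ = 1 ∧ k v₁ = u) ∧
      x = Γ.twist k fun e => zpowersHom G h (a e)).card : ℂ) := by
  rw [orbitState, WithLp.ofLp_sum, Finset.sum_apply, Finset.card_filter, Nat.cast_sum]
  refine Finset.sum_congr rfl fun k _ => ?_
  by_cases hk : k v₀ = 1 ∧ k v₁ = u <;> simp [hk, ket]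

theorem orbitState_ne_zero (hv : v₀ ≠ v₁) : Γ.orbitState v₀ v₁ h a u ≠ 0 := by
  intro h0
  let k : Γ.Vertex → G := Pi.mulSingle v₁ u
  have := congrArg (fun ψ : Hilb E G => ψ (Γ.twist k fun e => zpowersHom G h (a e))) h0
  simp only [orbitState_apply, PiLp.zero_apply, Nat.cast_eq_zero, Finset.card_eq_zero,
    Finset.filter_eq_empty_iff] at this
  exact this (Finset.mem_univ k) ⟨⟨by simp [k, hv], by simp [k]⟩, rfl⟩

/-! ### Orbit states for a pair of sites -/

section Sites

variable {Γ} {s₀ s₁ : Γ.Site} {a}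

open scoped Classical in
/-- The integral connection `a` has flux `1` at the face of `s₀` and `-1` at the face of `s₁`. -/
def IsFlux (s₀ s₁ : Γ.Site) (a : E → Multiplicative ℤ) : Prop :=
  ∀ t, Γ.holonomy t a = (if Γ.face s₀ = Γ.face t then Multiplicative.ofAdd 1 else 1) *
      if Γ.face s₁ = Γ.face t then (Multiplicative.ofAdd 1)⁻¹ else 1

theorem IsFlux.holonomy_left (ha : IsFlux s₀ s₁ a) (hp : Γ.face s₀ ≠ Γ.face s₁)
    (k : Γ.Vertex → G) :
    Γ.holonomy s₀ (Γ.twist k fun e => zpowersHom G h (a e)) =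
      (k (Γ.vertex s₀))⁻¹ * h * k (Γ.vertex s₀) := by
  rw [holonomy_twist, holonomy_comp, ha, if_pos rfl, if_neg hp.symm, mul_one, zpowersHom_apply]
  simp

theorem IsFlux.holonomy_right (ha : IsFlux s₀ s₁ a) (hp : Γ.face s₀ ≠ Γ.face s₁)
    (k : Γ.Vertex → G) :
    Γ.holonomy s₁ (Γ.twist k fun e => zpowersHom G h (a e)) =
      (k (Γ.vertex s₁))⁻¹ * h⁻¹ * k (Γ.vertex s₁) := by
  rw [holonomy_twist, holonomy_comp, ha, if_pos rfl, if_neg hp, one_mul, map_inv, zpowersHom_apply]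
  simp

theorem IsFlux.holonomy_of_ne (ha : IsFlux s₀ s₁ a) {t : Γ.Site} (h₀ : Γ.face t ≠ Γ.face s₀)
    (h₁ : Γ.face t ≠ Γ.face s₁) (k : Γ.Vertex → G) :
    Γ.holonomy t (Γ.twist k fun e => zpowersHom G h (a e)) = 1 := by
  rw [holonomy_twist, holonomy_comp, ha, if_neg h₀.symm, if_neg h₁.symm]
  simp

/-- The supports are disjoint: a common connection has one flux at `s₀`, which forces `h = h'`, and
by `twist_injective` one normalized gauge, which forces `u = u'`. -/
theorem IsFlux.inner_orbitState_eq_zero (hΓ : Γ.IsPlanar) (ha : IsFlux s₀ s₁ a)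
    (hp : Γ.face s₀ ≠ Γ.face s₁) (h h' u u' : G) (hne : (h, u) ≠ (h', u')) :
    ⟪Γ.orbitState (Γ.vertex s₀) (Γ.vertex s₁) h a u,
      Γ.orbitState (Γ.vertex s₀) (Γ.vertex s₁) h' a u'⟫_ℂ = 0 := by
  rw [inner_orbitState]
  refine Finset.sum_eq_zero fun k _ => ?_
  split_ifs with hk
  · rw [orbitState_apply, Nat.cast_eq_zero, Finset.card_eq_zero, Finset.filter_eq_empty_iff]
    rintro k' - ⟨hk', hkk'⟩
    have h1 := ha.holonomy_left h hp k
    rw [hkk', ha.holonomy_left h' hp k', hk.1, hk'.1] at h1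
    obtain rfl : h' = h := by simpa using h1
    have h2 := Γ.twist_injective hΓ.1 (hk.1.trans hk'.1.symm) hkk'
    exact hne (Prod.ext rfl (by rw [← hk.2, ← hk'.2, h2]))
  · rfl

theorem IsFlux.orbitState_mem (ha : IsFlux s₀ s₁ a) (h u : G) :
    Γ.orbitState (Γ.vertex s₀) (Γ.vertex s₁) h a u ∈ Γ.stateSpace s₀ s₁ := by
  refine ⟨fun v h₀ h₁ => ?_, fun s h₀ h₁ => ?_⟩
  · rw [A_eq_self_iff]
    exact fun f => Γ.vertexAct_orbitState_of_ne _ _ _ _ _ v h₀ h₁ f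
  · rw [B, Γ.faceAct_orbitState _ _ _ _ _ (g := 1)
      (fun k _ _ => ha.holonomy_of_ne h h₀ h₁ k), if_pos rfl]

/-- The stabilizer of `ψ` is a subgroup, and `k` is a product of gauge transformations at single
vertices, nontrivial only where `A` fixes `ψ`. -/
theorem twistOp_eq_self {ψ : Hilb E G} (hψ : ψ ∈ Γ.stateSpace s₀ s₁) {k : Γ.Vertex → G}
    (h₀ : k (Γ.vertex s₀) = 1) (h₁ : k (Γ.vertex s₁) = 1) : Γ.twistOp k ψ = ψ := by
  let K : Subgroup (Γ.Vertex → G) :=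
    { carrier := {k | Γ.twistOp k ψ = ψ}
      mul_mem' := fun {k k'} hk hk' => by
        change Γ.twistOp (k * k') ψ = ψ
        rw [← twistOp_twistOp, hk, hk']
      one_mem' := by
        change Γ.twistOp 1 ψ = ψ
        rw [twistOp_one, LinearMap.id_apply]
      inv_mem' := fun {k} hk => by
        change Γ.twistOp k⁻¹ ψ = ψ
        have hk' : Γ.twistOp k ψ = ψ := hk
        conv_lhs => rw [← hk']
        rw [twistOp_twistOp, mul_inv_cancel, twistOp_one, LinearMap.id_apply] }
  suffices k ∈ K from this
  refine Subgroup.pi_mem_of_mulSingle_mem k fun v => ?_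
  by_cases hv₀ : v = Γ.vertex s₀
  · rw [hv₀, h₀, Pi.mulSingle_one]
    exact K.one_mem
  by_cases hv₁ : v = Γ.vertex s₁
  · rw [hv₁, h₁, Pi.mulSingle_one]
    exact K.one_mem
  have := (Γ.A_eq_self_iff v ψ).1 (hψ.1 v hv₀ hv₁) (k v)⁻¹
  rwa [vertexAct_eq_twistOp, inv_inv] at this

theorem IsFlux.span_orbitState (hΓ : Γ.IsPlanar) (ha : IsFlux s₀ s₁ a) :
    Submodule.span ℂ (Set.range fun i : G × G =>
      Γ.orbitState (Γ.vertex s₀) (Γ.vertex s₁) i.1 a i.2) = Γ.stateSpace s₀ s₁ := by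
  refine le_antisymm (Submodule.span_le.2 ?_) fun ψ hψ => ?_
  · rintro _ ⟨i, rfl⟩
    exact ha.orbitState_mem i.1 i.2
  let S : Finset (Γ.Vertex → G) :=
    Finset.univ.filter fun k => k (Γ.vertex s₀) = 1 ∧ k (Γ.vertex s₁) = 1
  have hS : (S.card : ℂ) ≠ 0 :=
    Nat.cast_ne_zero.2 (Finset.card_ne_zero_of_mem (a := 1) (by simp [S]))
  -- Averaging `ψ` over `S` does not change it, but replaces each basis vector of its support by an
  -- orbit sum.
  have h1 : (S.card : ℂ) • ψ = ∑ x, ψ x • ∑ k ∈ S, ket (Γ.twist k x) := by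
    simp only [Finset.smul_sum]
    rw [Finset.sum_comm, Nat.cast_smul_eq_nsmul, ← Finset.sum_const]
    refine Finset.sum_congr rfl fun k hk => ?_
    rw [← opOfKets_apply]
    rw [Finset.mem_filter] at hk
    exact (twistOp_eq_self hψ hk.2.1 hk.2.2).symm
  rw [← inv_smul_smul₀ hS ψ, h1]
  refine Submodule.smul_mem _ _ (Submodule.sum_mem _ fun x _ => ?_)
  by_cases hx : ψ x = 0
  · rw [hx, zero_smul]
    exact Submodule.zero_mem _
  refine Submodule.smul_mem _ _ ?_
  obtain ⟨k₀, h, hk₀, rfl⟩ := hΓ.exists_eq_twist_zpow (Γ.vertex s₀) s₀ s₁ a ha x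
    fun t ht₀ ht₁ => by
      by_contra hcon
      have := congrArg (fun φ : Hilb E G => φ x) (hψ.2 t ht₀ ht₁)
      simp only [B, faceAct_apply, if_neg hcon] at this
      exact hx this.symm
  refine Submodule.subset_span ⟨(h, k₀ (Γ.vertex s₁)), ?_⟩
  change Γ.orbitState _ _ h a (k₀ (Γ.vertex s₁)) = _
  rw [orbitState, Finset.sum_filter]
  -- The translate of `S` by `k₀` consists of the gauges with value 1 at `s₀` and `k₀ (Γ.vertex s₁)`
  -- at `s₁`.
  refine (Fintype.sum_equiv (Equiv.mulLeft k₀) _ _ fun k => ?_).symm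
  simp [twist_twist, hk₀]

/-! ### The ribbon states -/

theorem Ribbon.isFlux (ξ : Γ.Ribbon s₀ s₁) : IsFlux s₀ s₁ ξ.cochain := ξ.holonomy_cochain

/-- The vacuum is the sum of all flat connections, up to a factor. -/
theorem IsPlanar.exists_vac_eq (hΓ : Γ.IsPlanar) {vac : Hilb E G} (hvac : vac ∈ Γ.vacuum)
    (hvac0 : vac ≠ 0) (s₀ : Γ.Site) :
    ∃ c : ℂ, c ≠ 0 ∧ vac = c • Γ.orbitState (Γ.vertex s₀) (Γ.vertex s₀) 1 1 1 := by
  -- With both sites equal the fluxes cancel, so the trivial connection qualifies; its orbit states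
  -- do not depend on `h` and vanish unless `u = 1`.
  have ha : IsFlux s₀ s₀ (1 : E → Multiplicative ℤ) := fun t => by
    rw [holonomy_one]
    split_ifs <;> simp
  have h1 : vac ∈ Γ.stateSpace s₀ s₀ := ⟨fun v _ _ => hvac.1 v, fun s _ _ => hvac.2 s⟩
  rw [← ha.span_orbitState hΓ] at h1
  have h2 : vac ∈ Submodule.span ℂ {Γ.orbitState (Γ.vertex s₀) (Γ.vertex s₀) (1 : G) 1 1} := by
    refine Submodule.span_le.2 ?_ h1
    rintro _ ⟨⟨h, u⟩, rfl⟩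
    change Γ.orbitState _ _ h 1 u ∈ Submodule.span ℂ _
    by_cases hu : u = 1
    · have h3 : Γ.orbitState (Γ.vertex s₀) (Γ.vertex s₀) h 1 u =
          Γ.orbitState (Γ.vertex s₀) (Γ.vertex s₀) 1 1 1 := by simp [orbitState, hu]
      exact h3 ▸ Submodule.mem_span_singleton_self _
    · have h3 : Γ.orbitState (Γ.vertex s₀) (Γ.vertex s₀) h 1 u = 0 :=
        Finset.sum_eq_zero fun k _ => if_neg fun hk => hu (hk.2.symm.trans hk.1)
      exact h3 ▸ Submodule.zero_mem _
  obtain ⟨c, rfl⟩ := Submodule.mem_span_singleton.1 h2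
  refine ⟨c, ?_, rfl⟩
  rintro rfl
  exact hvac0 (zero_smul _ _)

/-- The trivial connection is also `h ^ 0`, so `run_twist_comp` applies to each gauge transform `k`
of it. The recorded element is `h ^ winding * k v₁`, with `v₁` the end vertex, and equating it with
`g` prescribes `k v₁`. -/
theorem Ribbon.op_orbitState (ξ : Γ.Ribbon s₀ s₁) (h g : G) :
    ξ.op h g (Γ.orbitState (Γ.vertex s₀) (Γ.vertex s₀) 1 1 1) =
      Γ.orbitState (Γ.vertex s₀) (Γ.vertex s₁) h ξ.cochain
        ((zpowersHom G h ξ.winding)⁻¹ * g) := by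
  rw [orbitState, orbitState, map_sum]
  refine Finset.sum_congr rfl fun k _ => ?_
  by_cases hk : k (Γ.vertex s₀) = 1
  · have h1 := Γ.run_twist_comp (zpowersHom G h) (Multiplicative.ofAdd 1) k ξ.1 s₀ 1
    have h2 : (fun e => zpowersHom G (1 : G) ((1 : E → Multiplicative ℤ) e)) =
      fun e => zpowersHom G h ((1 : E → Multiplicative ℤ) e) := by simp
    have h3 : zpowersHom G h (Multiplicative.ofAdd 1) = h := by simp [zpowersHom_apply]
    rw [hk, inv_one, one_mul, mul_one, one_mul, h3, ξ.2] at h1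
    simp only [hk, and_self, if_true, true_and, Ribbon.op, ribbonOpAux_ket, h2, h1,
      eq_inv_mul_iff_mul_eq]
    rfl
  · simp [hk]

end Sites

/-- Any two sites are connected by a ribbon. -/
theorem exists_ribbon
    (h : MulAction.IsPretransitive (Subgroup.closure {Γ.rot, flip} : Subgroup (Equiv.Perm (Dart E)))
      (Dart E)) (s₀ s₁ : Γ.Site) : Nonempty (Γ.Ribbon s₀ s₁) := by
  have happ : ∀ (w : List Triangle) (s : Γ.Site) (t : Triangle),
      Γ.endSite s (w ++ [t]) = Γ.step (Γ.endSite s w) t := by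
    intro w
    induction w with
    | nil => intro s t; rfl
    | cons t' w ih => intro s t; exact ih _ _
  let P : Dart E → Prop := fun d => ∃ w, Γ.endSite s₀ w = d
  have hstep : ∀ d t, P d → P (Γ.step d t) := by
    rintro _ t ⟨w, rfl⟩
    exact ⟨w ++ [t], happ w s₀ t⟩
  have hback : ∀ d, P (Γ.rot d) → P d := by
    intro d hd
    -- Triangles only rotate anticlockwise, but `rot` has finite order, so its inverse is one of its
    -- powers.
    have key : ∀ n : ℕ, P ((Γ.rot ^ n) (Γ.rot d)) := by
      intro n
      induction n with
      | zero => exact hd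
      | succ n ih =>
        rw [pow_succ']
        exact hstep _ .dual ih
    have := key (orderOf Γ.rot - 1)
    rwa [← Equiv.Perm.mul_apply, ← pow_succ, Nat.sub_add_cancel (orderOf_pos _),
      pow_orderOf_eq_one] at this
  have hflip : ∀ d, P d → P (flip d) := by
    intro d hd
    have h1 : P (Γ.rot.symm d) := hback _ (by rwa [Equiv.apply_symm_apply])
    have h2 := hstep _ .direct h1
    rwa [step, Equiv.apply_symm_apply] at h2
  obtain ⟨w, hw⟩ := Γ.induction_of_isPretransitive h P (fun d => ⟨hback d, hstep d .dual⟩)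
    (fun d => ⟨fun hd => by simpa [flip_flip] using hflip _ hd, hflip d⟩) s₀ ⟨[], rfl⟩ s₁
  exact ⟨⟨w, hw⟩⟩

end Lattice

variable {G E : Type*} [Group G] [Fintype G] [DecidableEq G] [Fintype E] [DecidableEq E]

/-! ### From ribbon states to the quantum double -/

theorem QDouble.induction_on {P : QDouble G → Prop} (a : QDouble G)
    (hdelta : ∀ h g, P (delta h g)) (hzero : P 0) (hadd : ∀ a b, P a → P b → P (a + b))
    (hsmul : ∀ (c : ℂ) a, P a → P (c • a)) : P a := by
  have h1 : a = ∑ i : G × G, a i • delta i.1 i.2 := by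
    have h2 : ∀ (S : Finset (G × G)) (j : G × G),
        (∑ i ∈ S, a i • delta i.1 i.2 : QDouble G) j = ∑ i ∈ S, a i * delta i.1 i.2 j := by
      intro S j
      induction S using Finset.induction_on with
      | empty => rfl
      | insert i S hi ih => rw [Finset.sum_insert hi, Finset.sum_insert hi, add_apply, smul_apply, ih]
    funext j
    rw [h2, Finset.sum_eq_single j]
    · simp [delta]
    · intro i _ hi
      simp [delta, hi.symm]
    · simp
  rw [h1]
  exact Finset.sum_induction _ P hadd hzero fun i _ => hsmul _ _ (hdelta _ _)

namespace Lattice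

theorem siteAct_delta (Γ : Lattice E) (s : Γ.Site) (p f : G) :
    Γ.siteAct s (QDouble.delta p f) = Γ.faceAct s p ∘ₗ Γ.vertexAct (Γ.vertex s) f := by
  change ∑ g : G, ∑ h : G, QDouble.delta p f (g, h) • _ = _
  rw [Finset.sum_eq_single p, Finset.sum_eq_single f]
  · simp [QDouble.delta]
  · intro h _ hh
    simp [QDouble.delta, hh]
  · simp
  · intro g _ hg
    simp [QDouble.delta, hg]
  · simp

variable {Γ : Lattice E} {s₀ s₁ : Γ.Site}

/-- The isomorphism with the quantum double that belongs to a basis of the state space on which the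
site actions are given by the formulas for ribbon states. -/
theorem exists_linearEquiv_qDouble {L : Submodule ℂ (Hilb E G)} (b : Module.Basis (G × G) ℂ L)
    (h₁ : ∀ f h g : G, Γ.vertexAct (Γ.vertex s₀) f (b (h, g) : Hilb E G) =
      b (f * h * f⁻¹, f * g))
    (h₂ : ∀ f h g : G, Γ.faceAct s₀ f (b (h, g) : Hilb E G) =
      if f = h then (b (h, g) : Hilb E G) else 0)
    (h₃ : ∀ f h g : G, Γ.vertexAct (Γ.vertex s₁) f (b (h, g) : Hilb E G) = b (h, g * f⁻¹))
    (h₄ : ∀ f h g : G, Γ.faceAct s₁ f (b (h, g) : Hilb E G) =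
      if f = g⁻¹ * h⁻¹ * g then (b (h, g) : Hilb E G) else 0) :
    ∃ Θ : L ≃ₗ[ℂ] QDouble G,
      (∀ h g : G, Θ.symm (QDouble.delta h g) = b (h, g)) ∧
      ∀ a x : QDouble G,
        Γ.siteAct s₀ a (Θ.symm x : Hilb E G) = Θ.symm (a * x) ∧
        Γ.siteAct s₁ a (Θ.symm x : Hilb E G) = Θ.symm (x * QDouble.antipode a) := by
  let Θ : L ≃ₗ[ℂ] QDouble G := b.equivFun
  have hΘ : ∀ h g : G, Θ.symm (QDouble.delta h g) = b (h, g) := by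
    intro h g
    rw [LinearEquiv.symm_apply_eq]
    funext i
    change _ = b.equivFun (b (h, g)) i
    rw [Module.Basis.equivFun_self]
    simp [QDouble.delta, eq_comm]
  refine ⟨Θ, hΘ, fun a x => ⟨?_, ?_⟩⟩
  · induction a using QDouble.induction_on with
    | hzero => simp
    | hadd a a' ha ha' => rw [map_add, LinearMap.add_apply, ha, ha', add_mul, map_add,
        Submodule.coe_add]
    | hsmul c a ha => rw [map_smul, LinearMap.smul_apply, ha, smul_mul_assoc, map_smul,
        Submodule.coe_smul]
    | hdelta p f =>
      induction x using QDouble.induction_on with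
      | hzero => simp
      | hadd x x' hx hx' => rw [map_add, Submodule.coe_add, map_add, hx, hx', mul_add, map_add,
          Submodule.coe_add]
      | hsmul c x hx => rw [map_smul, Submodule.coe_smul, map_smul, hx, mul_smul_comm, map_smul,
          Submodule.coe_smul]
      | hdelta h g =>
        rw [siteAct_delta, LinearMap.comp_apply, hΘ, h₁, h₂, QDouble.delta_mul_delta]
        split_ifs with hp
        · rw [hΘ, hp]
        · rw [map_zero, Submodule.coe_zero]
  · induction a using QDouble.induction_on with
    | hzero => simp
    | hadd a a' ha ha' => rw [map_add, LinearMap.add_apply, ha, ha', map_add, mul_add, map_add,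
        Submodule.coe_add]
    | hsmul c a ha => rw [map_smul, LinearMap.smul_apply, ha, map_smul, mul_smul_comm, map_smul,
        Submodule.coe_smul]
    | hdelta p f =>
      induction x using QDouble.induction_on with
      | hzero => simp
      | hadd x x' hx hx' => rw [map_add, Submodule.coe_add, map_add, hx, hx', add_mul, map_add,
          Submodule.coe_add]
      | hsmul c x hx => rw [map_smul, Submodule.coe_smul, map_smul, hx, smul_mul_assoc, map_smul,
          Submodule.coe_smul]
      | hdelta h g =>
        rw [siteAct_delta, LinearMap.comp_apply, hΘ, h₃, h₄, QDouble.antipode_delta,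
          QDouble.delta_mul_delta]
        -- On the left is the flux condition at `s₁` after `f` has acted; on the right, the
        -- condition for `δ_h g · S(δ_p f)` to be nonzero.
        have hiff : p = (g * f⁻¹)⁻¹ * h⁻¹ * (g * f⁻¹) ↔ h = g * (f⁻¹ * p⁻¹ * f) * g⁻¹ := by
          constructor
          · rintro rfl
            group
          · intro hh
            rw [hh]
            group
        simp only [hiff]
        split_ifs with hp
        · rw [hΘ]
        · rw [map_zero, Submodule.coe_zero]

section Ribbon

theorem Ribbon.op_vac (ξ : Γ.Ribbon s₀ s₁) {vac : Hilb E G} {c : ℂ}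
    (hvac : vac = c • Γ.orbitState (Γ.vertex s₀) (Γ.vertex s₀) 1 1 1) (h g : G) :
    ξ.op h g vac = c • Γ.orbitState (Γ.vertex s₀) (Γ.vertex s₁) h ξ.cochain
      ((zpowersHom G h ξ.winding)⁻¹ * g) := by
  rw [hvac, map_smul, op_orbitState]

/-- Two ribbons with the same end sites create the same states up to a relabelling. -/
theorem Ribbon.op_vac_eq_of_twist (ξ ξ' : Γ.Ribbon s₀ s₁) {vac : Hilb E G} {c : ℂ}
    (hvac : vac = c • Γ.orbitState (Γ.vertex s₀) (Γ.vertex s₀) 1 1 1)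
    {b : Γ.Vertex → Multiplicative ℤ} (hb : b (Γ.vertex s₀) = 1)
    (hξξ' : ξ'.cochain = Γ.twist b ξ.cochain) (h g : G) :
    ξ'.op h g vac =
      ξ.op h (zpowersHom G h (ξ.winding * b (Γ.vertex s₁) * ξ'.winding⁻¹) * g) vac := by
  rw [ξ.op_vac hvac, ξ'.op_vac hvac, hξξ', orbitState_twist _ _ _ _ _ _ _ hb]
  simp only [map_mul, map_inv, mul_assoc, inv_mul_cancel_left]

/-- For fixed `h`, the shift of `g` by the winding is a bijection, and `c` is invertible; so ribbon
states and orbit states have the same span. -/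
theorem Ribbon.span_op_vac (hΓ : Γ.IsPlanar) (ξ : Γ.Ribbon s₀ s₁) {vac : Hilb E G} {c : ℂ}
    (hc : c ≠ 0) (hvac : vac = c • Γ.orbitState (Γ.vertex s₀) (Γ.vertex s₀) 1 1 1) :
    Submodule.span ℂ (Set.range fun i : G × G => ξ.op i.1 i.2 vac) = Γ.stateSpace s₀ s₁ := by
  rw [← ξ.isFlux.span_orbitState hΓ]
  refine le_antisymm (Submodule.span_le.2 ?_) (Submodule.span_le.2 ?_)
  · rintro _ ⟨⟨h, g⟩, rfl⟩
    change ξ.op h g vac ∈ Submodule.span ℂ _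
    rw [ξ.op_vac hvac]
    exact Submodule.smul_mem _ _ (Submodule.subset_span ⟨(h, _), rfl⟩)
  · rintro _ ⟨⟨h, u⟩, rfl⟩
    change Γ.orbitState _ _ h _ u ∈ Submodule.span ℂ _
    have h1 := ξ.op_vac hvac h (zpowersHom G h ξ.winding * u)
    rw [inv_mul_cancel_left] at h1
    rw [← inv_smul_smul₀ hc (Γ.orbitState (Γ.vertex s₀) (Γ.vertex s₁) h ξ.cochain u), ← h1]
    exact Submodule.smul_mem _ _ (Submodule.subset_span ⟨(h, _), rfl⟩)

theorem Ribbon.inner_op_vac (hΓ : Γ.IsPlanar) (ξ : Γ.Ribbon s₀ s₁) {vac : Hilb E G} {c : ℂ}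
    (hvac : vac = c • Γ.orbitState (Γ.vertex s₀) (Γ.vertex s₀) 1 1 1)
    (hs : Γ.Disjoint s₀ s₁) {h g h' g' : G} (hne : (h, g) ≠ (h', g')) :
    ⟪ξ.op h g vac, ξ.op h' g' vac⟫_ℂ = 0 := by
  rw [ξ.op_vac hvac, ξ.op_vac hvac, inner_smul_left, inner_smul_right,
    ξ.isFlux.inner_orbitState_eq_zero hΓ hs.2, mul_zero, mul_zero]
  intro heq
  obtain ⟨rfl, h2⟩ := Prod.mk.inj heq
  exact hne (by rw [mul_left_cancel h2])

theorem Ribbon.exists_basis (hΓ : Γ.IsPlanar) (ξ : Γ.Ribbon s₀ s₁) {vac : Hilb E G} {c : ℂ}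
    (hc : c ≠ 0) (hvac : vac = c • Γ.orbitState (Γ.vertex s₀) (Γ.vertex s₀) 1 1 1)
    (hs : Γ.Disjoint s₀ s₁) :
    ∃ b : Module.Basis (G × G) ℂ (Γ.stateSpace (G := G) s₀ s₁),
      ∀ h g : G, (b (h, g) : Hilb E G) = ξ.op h g vac := by
  have hli : LinearIndependent ℂ fun i : G × G => ξ.op i.1 i.2 vac := by
    refine linearIndependent_of_ne_zero_of_inner_eq_zero (fun i => ?_)
      fun i j hij => ξ.inner_op_vac hΓ hvac hs hij
    rw [ξ.op_vac hvac]
    exact smul_ne_zero hc (Γ.orbitState_ne_zero _ _ _ _ _ hs.1)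
  refine ⟨(Module.Basis.span hli).map (LinearEquiv.ofEq _ _ (ξ.span_op_vac hΓ hc hvac)),
    fun h g => ?_⟩
  rw [Module.Basis.map_apply, LinearEquiv.coe_ofEq_apply, Module.Basis.span_apply]

theorem Ribbon.siteAct_op_vac (ξ : Γ.Ribbon s₀ s₁) {vac : Hilb E G} {c : ℂ}
    (hvac : vac = c • Γ.orbitState (Γ.vertex s₀) (Γ.vertex s₀) 1 1 1)
    (hs : Γ.Disjoint s₀ s₁) (f h g : G) :
    Γ.vertexAct (Γ.vertex s₀) f (ξ.op h g vac) = ξ.op (f * h * f⁻¹) (f * g) vac ∧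
    Γ.faceAct s₀ f (ξ.op h g vac) = (if f = h then ξ.op h g vac else 0) ∧
    Γ.vertexAct (Γ.vertex s₁) f (ξ.op h g vac) = ξ.op h (g * f⁻¹) vac ∧
    Γ.faceAct s₁ f (ξ.op h g vac) = (if f = g⁻¹ * h⁻¹ * g then ξ.op h g vac else 0) := by
  simp only [ξ.op_vac hvac, map_smul]
  refine ⟨?_, ?_, ?_, ?_⟩
  · rw [vertexAct_orbitState_left _ _ _ _ _ _ hs.1]
    congr 2
    rw [zpowersHom_apply, zpowersHom_apply, conj_zpow]
    group
  · rw [Γ.faceAct_orbitState _ _ _ _ _ (g := h), smul_ite, smul_zero]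
    intro k hk _
    rw [ξ.isFlux.holonomy_left h hs.2, hk]
    simp
  · rw [vertexAct_orbitState_right _ _ _ _ _ _ hs.1, mul_assoc]
  · rw [Γ.faceAct_orbitState _ _ _ _ _ (g := g⁻¹ * h⁻¹ * g), smul_ite, smul_zero]
    intro k _ hk
    -- The winding contributes a power of `h`, which commutes with the flux `h⁻¹` and drops out.
    rw [ξ.isFlux.holonomy_right h hs.2, hk, zpowersHom_apply]
    group

end Ribbon

end Lattice
end Kitaev

theorem mainTheorem7 {G : Type*} [Group G] [Fintype G] [DecidableEq G]
    {E : Type*} [Fintype E] [DecidableEq E] (Γ : Kitaev.Lattice E) (hΓ : Γ.IsPlanar)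
    (vac : Kitaev.Hilb E G) (hvac : vac ∈ Γ.vacuum) (hvac0 : vac ≠ 0) (s₀ s₁ : Γ.Site) :
    -- (1) dependence on the ribbon
    ((∀ ξ ξ' : Γ.Ribbon s₀ s₁, ξ.NonSelfCrossing → ξ'.NonSelfCrossing →
        (ξ.Homotopic ξ' ∨ ¬ Γ.Disjoint s₀ s₁) →
        ∀ h g : G, ξ.op h g vac = ξ'.op h g vac) ∧
      ∀ ξ ξ' : Γ.Ribbon s₀ s₁, ∃ n : ℤ, ∀ h g : G, ξ'.op h g vac = ξ.op h (h ^ n * g) vac) ∧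
    -- (2) the states span
    (∀ ξ : Γ.Ribbon s₀ s₁,
      Submodule.span ℂ (Set.range fun i : G × G => ξ.op i.1 i.2 vac) = Γ.stateSpace s₀ s₁) ∧
    -- (3) they form an orthogonal basis if the sites are disjoint
    (Γ.Disjoint s₀ s₁ → ∀ ξ : Γ.Ribbon s₀ s₁,
      (∃ b : Module.Basis (G × G) ℂ (Γ.stateSpace (G := G) s₀ s₁),
        ∀ h g : G, (b (h, g) : Kitaev.Hilb E G) = ξ.op h g vac) ∧
      ∀ h g h' g' : G, (h, g) ≠ (h', g') → ⟪ξ.op h g vac, ξ.op h' g' vac⟫_ℂ = 0) ∧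
    -- (4) the site actions at disjoint sites
    (Γ.Disjoint s₀ s₁ →
      (∀ (a : Kitaev.QDouble G), ∀ ψ ∈ Γ.stateSpace (G := G) s₀ s₁,
        Γ.siteAct s₀ a ψ ∈ Γ.stateSpace (G := G) s₀ s₁ ∧
        Γ.siteAct s₁ a ψ ∈ Γ.stateSpace (G := G) s₀ s₁) ∧
      ∀ ξ : Γ.Ribbon s₀ s₁,
        (∀ f h g : G,
          Γ.vertexAct (Γ.vertex s₀) f (ξ.op h g vac) = ξ.op (f * h * f⁻¹) (f * g) vac ∧
          Γ.faceAct s₀ f (ξ.op h g vac) = (if f = h then ξ.op h g vac else 0) ∧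
          Γ.vertexAct (Γ.vertex s₁) f (ξ.op h g vac) = ξ.op h (g * f⁻¹) vac ∧
          Γ.faceAct s₁ f (ξ.op h g vac) =
            (if f = g⁻¹ * h⁻¹ * g then ξ.op h g vac else 0)) ∧
        ∃ Θ : Γ.stateSpace (G := G) s₀ s₁ ≃ₗ[ℂ] Kitaev.QDouble G,
          (∀ h g : G, (Θ.symm (Kitaev.QDouble.delta h g) : Kitaev.Hilb E G) = ξ.op h g vac) ∧
          ∀ a x : Kitaev.QDouble G,
            Γ.siteAct s₀ a (Θ.symm x : Kitaev.Hilb E G) = Θ.symm (a * x) ∧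
            Γ.siteAct s₁ a (Θ.symm x : Kitaev.Hilb E G) =
              Θ.symm (x * Kitaev.QDouble.antipode a)) := by 
  obtain ⟨c, hc, hvc⟩ := hΓ.exists_vac_eq hvac hvac0 s₀
  refine ⟨⟨fun ξ ξ' hξ hξ' hh h g => ?_, fun ξ ξ' => ?_⟩, fun ξ => ξ.span_op_vac hΓ hc hvc,
    fun hs ξ => ⟨ξ.exists_basis hΓ hc hvc hs, fun h g h' g' hne => ξ.inner_op_vac hΓ hvc hs hne⟩,
    fun hs => ?_⟩
  · obtain ⟨b, hb, hξξ'⟩ := hΓ.exists_cochain_eq_twist ξ ξ'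
    rw [ξ.op_vac_eq_of_twist ξ' hvc hb hξξ', hξ.winding_eq_one, hξ'.winding_eq_one,
      hΓ.twist_eq_one_of_nonSelfCrossing hξ hξ' hh hb hξξ']
    simp
  · obtain ⟨b, hb, hξξ'⟩ := hΓ.exists_cochain_eq_twist ξ ξ'
    exact ⟨Multiplicative.toAdd (ξ.winding * b (Γ.vertex s₁) * ξ'.winding⁻¹),
      fun h g => ξ.op_vac_eq_of_twist ξ' hvc hb hξξ' h g⟩
  · have hΘ : ∀ ξ : Γ.Ribbon s₀ s₁, ∃ Θ : Γ.stateSpace (G := G) s₀ s₁ ≃ₗ[ℂ] Kitaev.QDouble G,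
        (∀ h g : G, (Θ.symm (Kitaev.QDouble.delta h g) : Kitaev.Hilb E G) = ξ.op h g vac) ∧
        ∀ a x : Kitaev.QDouble G,
          Γ.siteAct s₀ a (Θ.symm x : Kitaev.Hilb E G) = Θ.symm (a * x) ∧
          Γ.siteAct s₁ a (Θ.symm x : Kitaev.Hilb E G) =
            Θ.symm (x * Kitaev.QDouble.antipode a) := by
      intro ξ
      obtain ⟨b, hb⟩ := ξ.exists_basis hΓ hc hvc hs
      have hact := ξ.siteAct_op_vac hvc hs
      obtain ⟨Θ, h1, h2⟩ := Kitaev.Lattice.exists_linearEquiv_qDouble (s₀ := s₀) (s₁ := s₁) b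
        (fun f h g => by rw [hb, hb]; exact (hact f h g).1)
        (fun f h g => by rw [hb]; exact (hact f h g).2.1)
        (fun f h g => by rw [hb, hb]; exact (hact f h g).2.2.1)
        (fun f h g => by rw [hb]; exact (hact f h g).2.2.2)
      exact ⟨Θ, fun h g => by rw [h1, hb], h2⟩
    refine ⟨fun a ψ hψ => ?_, fun ξ => ⟨ξ.siteAct_op_vac hvc hs, hΘ ξ⟩⟩
    -- Invariance mentions no ribbon, so some ribbon has to be provided for the isomorphism.
    obtain ⟨Θ, -, h2⟩ := hΘ (Γ.exists_ribbon hΓ.1 s₀ s₁).some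
    have h3 := h2 a (Θ ⟨ψ, hψ⟩)
    rw [LinearEquiv.symm_apply_apply] at h3
    rw [h3.1, h3.2]
    exact ⟨Submodule.coe_mem _, Submodule.coe_mem _⟩
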